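/- Let $F$ be the free pro-$3$ group on two generators $x,y$, let $\sigma:F\to F$ be the continuous automorphism with $\sigma(x)=x^{-1}$, $\sigma(y)=y^{-1}$, let $t=yxyx^{-1}y\in F$, and let \[ H=\langle x,y \mid x^3,\ t^{-1}\sigma(t)\rangle \] as a pro-$3$ group, that is, the quotient of $F$ by the closed normal subgroup generated by $x^3$ and $t^{-1}\sigma(t)$. Let $\mathbb{Z}_3$ be the ring of $3$-adic integers, and let $\alpha\in\mathbb{Z}_3$ satisfy $\alpha^2=-2$ and $\alpha\equiv 1\pmod 3$. Then there is a unique continuous homomorphism $\rho:H\to \mathrm{SL}_2(\mathbb{Z}_3)$ with \[ \rho(x)=\begin{pmatrix}0&-1\\1&-1\end{pmatrix},\qquad \rho(y)=\alpha\begin{pmatrix}0&1/2\\1&-1\end{pmatrix}, \] and $\rho$ is an isomorphism of topological groups from $H$ onto a pro-$3$ Sylow subgroup $P$ of $\mathrm{SL}_2(\mathbb{Z}_3)$, that is, onto a closed pro-$3$ subgroup $P$ such that every open subgroup of $\mathrm{SL}_2(\mathbb{Z}_3)$ containing $P$ has index prime to $3$. -/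

import Mathlib

/-- The normal subgroups of an abstract group `G` whose index is a power of `p`. -/
def PPowerNormalSubgroup (p : ℕ) (G : Type*) [Group G] : Type _ :=
  {N : Subgroup G // N.Normal ∧ ∃ k : ℕ, N.index = p ^ k}

namespace PPowerNormalSubgroup

variable {p : ℕ} {G G' : Type*} [Group G] [Group G']

instance (N : PPowerNormalSubgroup p G) : N.1.Normal := N.2.1

/-- The preimage of a normal subgroup of `p`-power index under a homomorphism. -/
def comap [Fact p.Prime] (φ : G →* G') (N : PPowerNormalSubgroup p G') :
    PPowerNormalSubgroup p G :=
  ⟨N.1.comap φ, inferInstance, by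
    obtain ⟨k, hk⟩ := N.2.2
    have h : (N.1.comap φ).index ∣ p ^ k := by
      rw [Subgroup.index_comap, ← hk]
      exact Subgroup.relIndex_dvd_index_of_normal _ _
    obtain ⟨m, -, hm⟩ := (Nat.dvd_prime_pow (Fact.out : p.Prime)).1 h
    exact ⟨m, hm⟩⟩

/-- The finite `p`-group `G ⧸ N`. -/
def Quot (N : PPowerNormalSubgroup p G) : Type _ := G ⧸ N.1

instance (N : PPowerNormalSubgroup p G) : Group N.Quot :=
  inferInstanceAs (Group (G ⧸ N.1))

/-- The finite quotient `G ⧸ N` carries the discrete topology. -/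
instance (N : PPowerNormalSubgroup p G) : TopologicalSpace N.Quot := ⊥

instance (N : PPowerNormalSubgroup p G) : DiscreteTopology N.Quot := ⟨rfl⟩

/-- The projection `G → G ⧸ N`. -/
def mk (N : PPowerNormalSubgroup p G) : G →* N.Quot := QuotientGroup.mk' N.1

/-- The transition map `G ⧸ N → G ⧸ M` for `N ≤ M`. -/
def trans {N M : PPowerNormalSubgroup p G} (h : N.1 ≤ M.1) : N.Quot →* M.Quot :=
  QuotientGroup.map N.1 M.1 (MonoidHom.id G) h

/-- The homomorphism `G ⧸ φ⁻¹(N) → G' ⧸ N` induced by `φ : G → G'`. -/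
def quotMap [Fact p.Prime] (φ : G →* G') (N : PPowerNormalSubgroup p G') :
    (N.comap φ).Quot →* N.Quot :=
  QuotientGroup.map (N.comap φ).1 N.1 φ le_rfl

end PPowerNormalSubgroup

/-- The pro-`p` completion of an abstract group `G`, as a group of compatible families: the inverse
limit of the quotients `G ⧸ N`, over the normal subgroups `N` of `p`-power index. -/
def proPCompletionSubgroup (p : ℕ) (G : Type*) [Group G] :
    Subgroup (∀ N : PPowerNormalSubgroup p G, N.Quot) where
  carrier := {f | ∀ (N M : PPowerNormalSubgroup p G) (h : N.1 ≤ M.1),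
    PPowerNormalSubgroup.trans h (f N) = f M}
  one_mem' := fun N M h => map_one _
  mul_mem' := fun {a b} ha hb N M h => by
    rw [Pi.mul_apply, Pi.mul_apply, map_mul, ha N M h, hb N M h]
  inv_mem' := fun {a} ha N M h => by
    rw [Pi.inv_apply, Pi.inv_apply, map_inv, ha N M h]

/-- The pro-`p` completion of `G`, with the topology induced from the product of the finite
discrete groups `G ⧸ N`. -/
abbrev ProPCompletion (p : ℕ) (G : Type*) [Group G] : Type _ := proPCompletionSubgroup p G

namespace ProPCompletion

variable {p : ℕ} {G G' : Type*} [Group G] [Group G']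

/-- The canonical homomorphism from `G` to its pro-`p` completion. -/
def of (p : ℕ) (G : Type*) [Group G] : G →* ProPCompletion p G where
  toFun g := ⟨fun N => N.mk g, fun _ _ _ => rfl⟩
  map_one' := rfl
  map_mul' _ _ := rfl

/-- The continuous homomorphism of pro-`p` completions induced by a homomorphism of groups. -/
def map [Fact p.Prime] (φ : G →* G') : ProPCompletion p G →ₜ* ProPCompletion p G' where
  toFun f := ⟨fun N => PPowerNormalSubgroup.quotMap φ N (f.1 (N.comap φ)), fun N M h => by
    change PPowerNormalSubgroup.trans h (PPowerNormalSubgroup.quotMap φ N (f.1 (N.comap φ))) =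
      PPowerNormalSubgroup.quotMap φ M (f.1 (M.comap φ))
    rw [← f.2 (N.comap φ) (M.comap φ) (Subgroup.comap_mono h)]
    obtain ⟨g, hg⟩ := QuotientGroup.mk_surjective (s := (N.comap φ).1) (f.1 (N.comap φ))
    rw [← hg]
    rfl⟩
  map_one' := by
    ext N
    exact map_one _
  map_mul' a b := by
    ext N
    exact map_mul _ _ _
  continuous_toFun := by
    refine Continuous.subtype_mk (continuous_pi fun N => ?_) _
    exact continuous_of_discreteTopology.comp
      ((continuous_apply (N.comap φ)).comp continuous_subtype_val)

theorem map_of [Fact p.Prime] (φ : G →* G') (g : G) : map φ (of p G g) = of p G' (φ g) := rfl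

end ProPCompletion

/-- The free pro-`p` group on `n` generators: the pro-`p` completion of the free group of
rank `n`. -/
abbrev FreeProP (p n : ℕ) : Type := ProPCompletion p (FreeGroup (Fin n))

/-- The `i`-th free generator of the free pro-`p` group. -/
def FreeProP.gen (p n : ℕ) (i : Fin n) : FreeProP p n :=
  ProPCompletion.of p _ (FreeGroup.of i)

instance (p n : ℕ) (R : Set (FreeProP p n)) :
    (Subgroup.normalClosure R).topologicalClosure.Normal :=
  Subgroup.is_normal_topologicalClosure _

/-- The pro-`p` group on `n` generators with the set `R` of relators: the quotient of the free
pro-`p` group by the closed normal subgroup generated by `R`. -/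
abbrev ProPPresentation (p n : ℕ) (R : Set (FreeProP p n)) : Type :=
  FreeProP p n ⧸ (Subgroup.normalClosure R).topologicalClosure

/-- A topological group is pro-`p` if it is profinite (compact, Hausdorff and totally disconnected)
and all its open normal subgroups have index a power of `p`. -/
structure IsProP (p : ℕ) (G : Type*) [Group G] [TopologicalSpace G] : Prop where
  isTopologicalGroup : IsTopologicalGroup G
  compactSpace : CompactSpace G
  t2Space : T2Space G
  totallyDisconnectedSpace : TotallyDisconnectedSpace G
  index_eq : ∀ N : Subgroup G, N.Normal → IsOpen (N : Set G) → ∃ k : ℕ, N.index = p ^ k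

/-- A pro-`p` Sylow subgroup of a profinite group `G`: a closed pro-`p` subgroup `P` whose
(supernatural) index is prime to `p`, that is, every open subgroup containing `P` has index
prime to `p`. -/
structure IsProPSylow (p : ℕ) {G : Type*} [Group G] [TopologicalSpace G] (P : Subgroup G) :
    Prop where
  isClosed : IsClosed (P : Set G)
  isProP : IsProP p P
  index_coprime : ∀ U : Subgroup G, IsOpen (U : Set G) → P ≤ U → Nat.Coprime p U.index

namespace SchurSigma

/-- The free pro-`3` group on two generators. -/
abbrev F : Type := FreeProP 3 2

/-- The first generator of `F`. -/
def x : F := FreeProP.gen 3 2 0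

/-- The second generator of `F`. -/
def y : F := FreeProP.gen 3 2 1

/-- The continuous endomorphism of `F` with `x ↦ x⁻¹` and `y ↦ y⁻¹`; it is an involution. -/
def σ : F →ₜ* F :=
  ProPCompletion.map (FreeGroup.lift fun i : Fin 2 => (FreeGroup.of i)⁻¹)

theorem σ_x : σ x = x⁻¹ := by
  unfold σ x FreeProP.gen
  rw [ProPCompletion.map_of, FreeGroup.lift_apply_of, map_inv]

theorem σ_y : σ y = y⁻¹ := by
  unfold σ y FreeProP.gen
  rw [ProPCompletion.map_of, FreeGroup.lift_apply_of, map_inv]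

theorem σ_σ (f : F) : σ (σ f) = f := by
  apply Subtype.ext
  funext N
  let φ : FreeGroup (Fin 2) →* FreeGroup (Fin 2) :=
    FreeGroup.lift fun i : Fin 2 => (FreeGroup.of i)⁻¹
  have hφ : ∀ g, φ (φ g) = g := fun g => by
    have : φ.comp φ = MonoidHom.id _ := by
      ext i
      simp [φ]
    exact DFunLike.congr_fun this g
  have hle : ((N.comap φ).comap φ).1 ≤ N.1 := fun g hg => by
    have h2 : φ (φ g) ∈ N.1 := hg
    rwa [hφ] at h2
  rw [← f.2 ((N.comap φ).comap φ) N hle]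
  change PPowerNormalSubgroup.quotMap φ N (PPowerNormalSubgroup.quotMap φ (N.comap φ)
    (f.1 ((N.comap φ).comap φ))) = _
  obtain ⟨g, hg⟩ := QuotientGroup.mk_surjective (s := ((N.comap φ).comap φ).1)
    (f.1 ((N.comap φ).comap φ))
  rw [← hg]
  change N.mk (φ (φ g)) = N.mk g
  rw [hφ]

/-- The element `t = y x y x⁻¹ y` of `F`. -/
def t : F := y * x * y * x⁻¹ * y

/-- The pro-`3` group `H = ⟨x, y ∣ x³, t⁻¹ σ(t)⟩`. -/
abbrev H : Type := ProPPresentation 3 2 {x ^ 3, t⁻¹ * σ t}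

/-- The image of the generator `x` in `H`. -/
def xH : H := (x : H)

/-- The image of the generator `y` in `H`. -/
def yH : H := (y : H)

/-- The element `1/2` of `ℤ₃`. -/
noncomputable def half : ℤ_[3] := Ring.inverse 2

theorem two_mul_half : 2 * half = 1 := by
  apply Ring.mul_inverse_cancel
  rw [PadicInt.isUnit_iff]
  have h := (PadicInt.norm_intCast_eq_one_iff (p := 3) (z := 2)).2 (by decide)
  exact_mod_cast h

end SchurSigma

/-! The argument takes place in the discrete group Γ with the generators and relators of H. Let z₀,
z₁, z₂ be the conjugates of yx⁻¹ under 1, x, x², and let Q be the subgroup they generate. Since x³ =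
1, Q is normal and Γ = Q⟨x⟩. The relation t = σ(t) amounts to z₂z₀z₂²z₀² = 1. With its conjugates
under x, it makes every commutator of the zᵢ a product of cubes. Hence, in the lower exponent-3
central series Q = P₀ ≥ P₁ ≥ ⋯, the 3ⁿ-th powers of the zᵢ generate Pₙ modulo Pₙ₊₁
(`lowerCubeSeries_le_powSup`), so that each layer has order at most 27.

On the matrix side zᵢ ↦ 1 + 3Aᵢ modulo 9, where the Aᵢ form a basis of the trace-zero matrices
modulo 3 (`firstOrder_gens`). Cubing moves the same Aᵢ one level up, so each layer of Q maps
isomorphically onto a layer of the congruence filtration. Therefore Pₙ is exactly the preimage of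
the congruence subgroup of level 3ⁿ⁺¹ (`map_mem_congr_iff`), and Γ is dense in the level-3 subgroup
at every stage.

Every normal subgroup of 3-power index contains some Pₙ (`exists_lowerCubeSeries_le`), so the pro-3
topology of Γ is the one pulled back from SL₂(ℤ₃). Passing to completions, the kernel on F is the
closed normal closure of the relators (`exists_rep_F`). The image contains the level-3 congruence
subgroup and an element of order 3 modulo 3. As |SL₂(𝔽₃)| = 24, its index is prime to 3. -/

open commutatorElement

/-! ### Cubing and the lower exponent-3 central series. -/

/-- If the commutator of `a` and `b` is central of exponent `3` modulo `N`, then cubing is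
multiplicative on `a` and `b` modulo `N`. -/
theorem QuotientGroup.mk_mul_pow_three {G : Type*} [Group G] (N : Subgroup G) [N.Normal] {a b : G}
    (h3 : ⁅b⁻¹, a⁻¹⁆ ^ 3 ∈ N) (ha : ⁅⁅b⁻¹, a⁻¹⁆, a⁆ ∈ N) (hb : ⁅⁅b⁻¹, a⁻¹⁆, b⁆ ∈ N) :
    (((a * b) ^ 3 : G) : G ⧸ N) = ((a ^ 3 * b ^ 3 : G) : G ⧸ N) := by
  have hba : b * a = a * b * ⁅b⁻¹, a⁻¹⁆ := by rw [commutatorElement_def]; group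
  generalize ⁅b⁻¹, a⁻¹⁆ = c at *
  rw [← QuotientGroup.eq_one_iff] at h3 ha hb
  have hba' := congrArg (QuotientGroup.mk' N) hba
  have ha' : Commute (c : G ⧸ N) a := by
    rw [← commutatorElement_eq_one_iff_commute]; exact ha
  have hb' : Commute (c : G ⧸ N) b := by
    rw [← commutatorElement_eq_one_iff_commute]; exact hb
  simp only [map_mul, QuotientGroup.mk'_apply] at hba'
  simp only [QuotientGroup.mk_mul, QuotientGroup.mk_pow] at h3 ⊢
  generalize (a : G ⧸ N) = a at *
  generalize (b : G ⧸ N) = b at *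
  generalize (c : G ⧸ N) = c at *
  calc (a * b) ^ 3 = a * (b * a) * (b * a) * b := by simp only [pow_succ, pow_zero]; group
    _ = a * (a * b * c) * (a * b * c) * b := by rw [hba']
    _ = a * a * b * (c * a) * b * (c * b) := by group
    _ = a * a * b * (a * c) * b * (b * c) := by rw [ha'.eq, hb'.eq]
    _ = a * a * (b * a) * (c * b) * b * c := by group
    _ = a * a * (a * b * c) * (b * c) * b * c := by rw [hba', hb'.eq]
    _ = a * a * a * b * (c * b) * (c * b) * c := by group
    _ = a * a * a * b * (b * c) * (b * c) * c := by rw [hb'.eq]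
    _ = a * a * a * b * b * (c * b) * c * c := by group
    _ = a * a * a * b * b * (b * c) * c * c := by rw [hb'.eq]
    _ = a ^ 3 * b ^ 3 * c ^ 3 := by simp only [pow_succ, pow_zero]; group
    _ = _ := by rw [h3, mul_one]

/-- The lower exponent-`3` central series of a subgroup `Q`. -/
def Subgroup.lowerCubeSeries {G : Type*} [Group G] (Q : Subgroup G) : ℕ → Subgroup G
  | 0 => Q
  | n + 1 => Subgroup.closure ({a | ∃ w ∈ Q.lowerCubeSeries n, w ^ 3 = a} ∪
      {a | ∃ w ∈ Q.lowerCubeSeries n, ∃ q ∈ Q, ⁅w, q⁆ = a})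

namespace Subgroup

variable {G : Type*} [Group G] {Q : Subgroup G}

theorem pow_three_mem_lowerCubeSeries {n : ℕ} {w : G} (hw : w ∈ Q.lowerCubeSeries n) :
    w ^ 3 ∈ Q.lowerCubeSeries (n + 1) :=
  subset_closure (Or.inl ⟨w, hw, rfl⟩)

theorem commutator_mem_lowerCubeSeries {n : ℕ} {w q : G} (hw : w ∈ Q.lowerCubeSeries n)
    (hq : q ∈ Q) : ⁅w, q⁆ ∈ Q.lowerCubeSeries (n + 1) :=
  subset_closure (Or.inr ⟨w, hw, q, hq, rfl⟩)

theorem lowerCubeSeries_succ_le_iff {n : ℕ} {S : Subgroup G} :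
    Q.lowerCubeSeries (n + 1) ≤ S ↔ (∀ w ∈ Q.lowerCubeSeries n, w ^ 3 ∈ S) ∧
      ∀ w ∈ Q.lowerCubeSeries n, ∀ q ∈ Q, ⁅w, q⁆ ∈ S := by
  refine ⟨fun h => ⟨fun w hw => h (pow_three_mem_lowerCubeSeries hw),
    fun w hw q hq => h (commutator_mem_lowerCubeSeries hw hq)⟩, fun h => (closure_le _).2 ?_⟩
  rintro _ (⟨w, hw, rfl⟩ | ⟨w, hw, q, hq, rfl⟩)
  exacts [h.1 w hw, h.2 w hw q hq]

instance lowerCubeSeries_normal [Q.Normal] (n : ℕ) : (Q.lowerCubeSeries n).Normal := by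
  induction n with
  | zero => assumption
  | succ n ih =>
    refine ⟨fun a ha g => ?_⟩
    have : Q.lowerCubeSeries (n + 1) ≤
        (Q.lowerCubeSeries (n + 1)).comap (MulAut.conj g).toMonoidHom := by
      rw [lowerCubeSeries_succ_le_iff]
      refine ⟨fun w hw => ?_, fun w hw q hq => ?_⟩
      · rw [mem_comap, map_pow]
        exact pow_three_mem_lowerCubeSeries (ih.conj_mem w hw g)
      · rw [mem_comap, map_commutatorElement]
        exact commutator_mem_lowerCubeSeries (ih.conj_mem w hw g)
          (‹Q.Normal›.conj_mem q hq g)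
    exact this ha

theorem lowerCubeSeries_succ_le [Q.Normal] (n : ℕ) :
    Q.lowerCubeSeries (n + 1) ≤ Q.lowerCubeSeries n := by
  rw [lowerCubeSeries_succ_le_iff]
  refine ⟨fun w hw => pow_mem hw 3, fun w hw q _ => ?_⟩
  rw [commutatorElement_def, mul_assoc, mul_assoc, ← mul_assoc q]
  exact mul_mem hw ((lowerCubeSeries_normal n).conj_mem _ (inv_mem hw) q)

theorem lowerCubeSeries_antitone [Q.Normal] : Antitone Q.lowerCubeSeries :=
  antitone_nat_of_succ_le lowerCubeSeries_succ_le

theorem lowerCubeSeries_le [Q.Normal] (n : ℕ) : Q.lowerCubeSeries n ≤ Q :=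
  lowerCubeSeries_antitone (Nat.zero_le n)

theorem pow_three_pow_mem_lowerCubeSeries {q : G} (hq : q ∈ Q) (n : ℕ) :
    q ^ 3 ^ n ∈ Q.lowerCubeSeries n := by
  induction n with
  | zero => rwa [pow_zero, pow_one]
  | succ n ih => rw [pow_succ, pow_mul]; exact pow_three_mem_lowerCubeSeries ih

/-- The commutator of two elements of the n-th term lies in term n + 1, so its cube and its
commutators with elements of Q vanish modulo term n + 2. -/
theorem mk_mul_pow_three_of_mem [Q.Normal] {n : ℕ} {a b : G} (ha : a ∈ Q.lowerCubeSeries n)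
    (hb : b ∈ Q.lowerCubeSeries n) :
    (((a * b) ^ 3 : G) : G ⧸ Q.lowerCubeSeries (n + 2)) =
      ((a ^ 3 * b ^ 3 : G) : G ⧸ Q.lowerCubeSeries (n + 2)) := by
  have hc := commutator_mem_lowerCubeSeries (inv_mem hb) (inv_mem (lowerCubeSeries_le n ha))
  exact QuotientGroup.mk_mul_pow_three _ (pow_three_mem_lowerCubeSeries hc)
    (commutator_mem_lowerCubeSeries hc (lowerCubeSeries_le n ha))
    (commutator_mem_lowerCubeSeries hc (lowerCubeSeries_le n hb))

theorem mem_iff_of_mk_eq {N S : Subgroup G} [N.Normal] (hNS : N ≤ S) {a b : G}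
    (h : (a : G ⧸ N) = b) : a ∈ S ↔ b ∈ S := by
  have h1 : a⁻¹ * b ∈ S := hNS (QuotientGroup.eq.1 h)
  exact ⟨fun ha => by simpa using mul_mem ha h1,
    fun hb => by simpa using mul_mem hb (inv_mem h1)⟩

/-- Write ⁅v³, q⁆ = v³(v⁻¹⁅v, q⁆)³. The commutator of v⁻¹ and ⁅v, q⁆ lies in term n + 2, so this
cube splits modulo term n + 3. -/
theorem commutator_pow_three_mem_iff [Q.Normal] {n : ℕ} {v q : G} {S : Subgroup G}
    (hS : Q.lowerCubeSeries (n + 3) ≤ S) (hv : v ∈ Q.lowerCubeSeries n) (hq : q ∈ Q) :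
    ⁅v ^ 3, q⁆ ∈ S ↔ ⁅v, q⁆ ^ 3 ∈ S := by
  have hc := commutator_mem_lowerCubeSeries hv hq
  have hd := commutator_mem_lowerCubeSeries (inv_mem hc)
    (inv_mem (inv_mem (lowerCubeSeries_le n hv)))
  have h := QuotientGroup.mk_mul_pow_three _ (pow_three_mem_lowerCubeSeries hd)
    (commutator_mem_lowerCubeSeries hd (inv_mem (lowerCubeSeries_le n hv)))
    (commutator_mem_lowerCubeSeries hd (lowerCubeSeries_le _ hc))
  have h1 : ⁅v ^ 3, q⁆ = v ^ 3 * (v⁻¹ * ⁅v, q⁆) ^ 3 := by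
    have : v⁻¹ * ⁅v, q⁆ = q * v⁻¹ * q⁻¹ := by rw [commutatorElement_def]; group
    rw [this, conj_pow, commutatorElement_def]; group
  have h2 : ⁅v, q⁆ ^ 3 = v ^ 3 * (v⁻¹ ^ 3 * ⁅v, q⁆ ^ 3) := by group
  rw [h1, h2]
  refine mem_iff_of_mk_eq hS ?_
  rw [QuotientGroup.mk_mul, QuotientGroup.mk_mul, h]

/-! ### Generation of the layers by powers of the generators. -/

/-- The subgroup generated by the `3 ^ n`-th powers of the `z i` and the next term of the series. -/
def powSup (Q : Subgroup G) {ι : Type*} (z : ι → G) (n : ℕ) : Subgroup G :=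
  closure (Set.range fun i => z i ^ 3 ^ n) ⊔ Q.lowerCubeSeries (n + 1)

theorem lowerCubeSeries_succ_le_powSup {ι : Type*} (z : ι → G) (n : ℕ) :
    Q.lowerCubeSeries (n + 1) ≤ powSup Q z n :=
  le_sup_right

theorem pow_mem_powSup {ι : Type*} (z : ι → G) (n : ℕ) (i : ι) : z i ^ 3 ^ n ∈ powSup Q z n :=
  (le_sup_left : _ ≤ powSup Q z n) (subset_closure ⟨i, rfl⟩)

section

variable [Q.Normal] {ι : Type*} {z : ι → G}

theorem powSup_le (hz : ∀ i, z i ∈ Q) (n : ℕ) : powSup Q z n ≤ Q.lowerCubeSeries n := by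
  refine sup_le ((closure_le _).2 ?_) (lowerCubeSeries_succ_le n)
  rintro _ ⟨i, rfl⟩
  exact pow_three_pow_mem_lowerCubeSeries (hz i) n

theorem conj_mem_powSup (hz : ∀ i, z i ∈ Q) {n : ℕ} {a s : G} (ha : a ∈ Q) (hs : s ∈ powSup Q z n) :
    a * s * a⁻¹ ∈ powSup Q z n := by
  have h : a * s * a⁻¹ = ⁅s, a⁆⁻¹ * s := by rw [commutatorElement_def]; group
  rw [h]
  exact mul_mem (inv_mem (lowerCubeSeries_succ_le_powSup z n
    (commutator_mem_lowerCubeSeries (powSup_le hz n hs) ha))) hs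

theorem closure_union_lowerCubeSeries (Q : Subgroup G) (z : ι → G) (n : ℕ) :
    closure (Set.range (fun i => z i ^ 3 ^ n) ∪ (Q.lowerCubeSeries (n + 1) : Set G)) =
      powSup Q z n := by
  rw [closure_union, closure_eq]; rfl

/-- Cubing is multiplicative from term n to the quotient by term n + 2, so it is enough to cube
generators. -/
theorem pow_three_mem_powSup (hz : ∀ i, z i ∈ Q) {n : ℕ}
    (hn : Q.lowerCubeSeries n ≤ powSup Q z n) {w : G} (hw : w ∈ Q.lowerCubeSeries n) :
    w ^ 3 ∈ powSup Q z (n + 1) := by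
  have hT := closure_union_lowerCubeSeries Q z n
  replace hw := hT ▸ hn hw
  induction hw using closure_induction with
  | mem w hw =>
    obtain ⟨i, rfl⟩ | hw := hw
    · rw [← pow_mul, ← pow_succ]
      exact pow_mem_powSup z (n + 1) i
    · exact lowerCubeSeries_succ_le_powSup z (n + 1) (pow_three_mem_lowerCubeSeries hw)
  | one => simp
  | mul a b ha hb pa pb =>
    rw [mem_iff_of_mk_eq (lowerCubeSeries_succ_le_powSup z (n + 1))
      (mk_mul_pow_three_of_mem (powSup_le hz n (hT ▸ ha)) (powSup_le hz n (hT ▸ hb)))]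
    exact mul_mem pa pb
  | inv a _ pa => rw [inv_pow]; exact inv_mem pa

/-- The identity ⁅ab, g⁆ = a⁅b, g⁆a⁻¹⁅a, g⁆ reduces commutators to generators as soon as `S` is
stable under conjugation by `T`. -/
theorem commutator_mem_of_forall_gen {S T : Subgroup G} {s : Set G}
    (hconj : ∀ a ∈ T, ∀ b ∈ S, a * b * a⁻¹ ∈ S) (hT : closure s = T) {g : G}
    (h : ∀ a ∈ s, ⁅a, g⁆ ∈ S) {w : G} (hw : w ∈ T) : ⁅w, g⁆ ∈ S := by
  subst hT
  induction hw using closure_induction with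
  | mem w hw => exact h w hw
  | one => simp
  | mul a b ha hb pa pb =>
    have : ⁅a * b, g⁆ = a * ⁅b, g⁆ * a⁻¹ * ⁅a, g⁆ := by simp only [commutatorElement_def]; group
    rw [this]
    exact mul_mem (hconj a ha _ pb) pa
  | inv a ha pa =>
    have : ⁅a⁻¹, g⁆ = a⁻¹ * ⁅a, g⁆⁻¹ * a⁻¹⁻¹ := by simp only [commutatorElement_def]; group
    rw [this]
    exact hconj _ (inv_mem ha) _ (inv_mem pa)

/-- If `Q` is generated by the `z i`, and their commutators are products of cubes, then each term
of the lower exponent-`3` central series is generated modulo the next one by the powers of the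
`z i`. -/
theorem lowerCubeSeries_le_powSup (hQ : closure (Set.range z) = Q)
    (hcomm : ∀ i j, ⁅z i, z j⁆ ∈ closure {a | ∃ w ∈ Q, w ^ 3 = a}) (n : ℕ) :
    Q.lowerCubeSeries n ≤ powSup Q z n := by
  have hz : ∀ i, z i ∈ Q := fun i => hQ ▸ subset_closure ⟨i, rfl⟩
  induction n with
  | zero =>
    refine le_trans hQ.ge (le_trans (closure_mono ?_) le_sup_left)
    rintro _ ⟨i, rfl⟩
    exact ⟨i, by simp⟩
  | succ n ih =>
    have hcube : ∀ w ∈ Q.lowerCubeSeries n, w ^ 3 ∈ powSup Q z (n + 1) :=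
      fun w => pow_three_mem_powSup hz ih
    have hconj : ∀ a ∈ Q, ∀ b ∈ powSup Q z (n + 1), a * b * a⁻¹ ∈ powSup Q z (n + 1) :=
      fun a ha b => conj_mem_powSup hz ha
    refine lowerCubeSeries_succ_le_iff.2 ⟨hcube, fun w hw q hq => ?_⟩
    -- The hypothesis on commutators is needed only at level 0. Above it, zᵢ^(3ⁿ⁺¹) is the cube of v
    -- = zᵢ^(3ⁿ), and ⁅v³, q⁆ may be replaced by the cube ⁅v, q⁆³.
    have hgen : ∀ i, ⁅z i ^ 3 ^ n, q⁆ ∈ powSup Q z (n + 1) := fun i => by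
      cases n with
      | zero =>
        rw [pow_zero, pow_one, ← inv_mem_iff, commutatorElement_inv]
        refine commutator_mem_of_forall_gen hconj hQ ?_ hq
        rintro _ ⟨j, rfl⟩
        refine (closure_le (powSup Q z 1)).2 ?_ (hcomm j i)
        rintro _ ⟨w, hw, rfl⟩
        exact hcube w hw
      | succ n =>
        have hv := pow_three_pow_mem_lowerCubeSeries (hz i) n
        rw [pow_succ, pow_mul, commutator_pow_three_mem_iff
          (lowerCubeSeries_succ_le_powSup z (n + 2)) hv hq]
        exact hcube _ (commutator_mem_lowerCubeSeries hv hq)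
    refine commutator_mem_of_forall_gen (fun a ha => hconj a (lowerCubeSeries_le n ha))
      ((closure_union_lowerCubeSeries Q z n).trans (le_antisymm (powSup_le hz n) ih)) ?_ hw
    rintro _ (⟨i, rfl⟩ | hw)
    exacts [hgen i, lowerCubeSeries_succ_le_powSup z (n + 1) (commutator_mem_lowerCubeSeries hw hq)]

theorem mk_pow_commute (hz : ∀ i, z i ∈ Q) (n : ℕ) (i j : ι) :
    Commute ((z i ^ 3 ^ n : G) : G ⧸ Q.lowerCubeSeries (n + 1))
      ((z j ^ 3 ^ n : G) : G ⧸ Q.lowerCubeSeries (n + 1)) := by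
  rw [← commutatorElement_eq_one_iff_commute]
  exact (QuotientGroup.eq_one_iff _).2 (commutator_mem_lowerCubeSeries
    (pow_three_pow_mem_lowerCubeSeries (hz i) n) (pow_mem (hz j) _))

/-- Modulo the next term, each element of a term of the lower exponent-`3` central series of a
group with three generators is a product of three powers. -/
theorem exists_zpow_mul_zpow_mul_zpow {z : Fin 3 → G} (hz : ∀ i, z i ∈ Q) {n : ℕ} {w : G}
    (hw : w ∈ powSup Q z n) : ∃ e : Fin 3 → ℤ, (w : G ⧸ Q.lowerCubeSeries (n + 1)) =
      (((z 0 ^ 3 ^ n) ^ e 0 * (z 1 ^ 3 ^ n) ^ e 1 * (z 2 ^ 3 ^ n) ^ e 2 : G) :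
        G ⧸ Q.lowerCubeSeries (n + 1)) := by
  have hc := mk_pow_commute hz n
  have h01 : ∀ a b : ℤ, _ := fun a b => ((hc 0 1).zpow_zpow a b).eq
  have h02 : ∀ a b : ℤ, _ := fun a b => ((hc 0 2).zpow_zpow a b).eq
  have h12 : ∀ a b : ℤ, _ := fun a b => ((hc 1 2).zpow_zpow a b).eq
  rw [← closure_union_lowerCubeSeries] at hw
  simp only [QuotientGroup.mk_mul, QuotientGroup.mk_zpow]
  induction hw using closure_induction with
  | mem w hw =>
    obtain ⟨i, rfl⟩ | hw := hw
    · refine ⟨Pi.single i 1, ?_⟩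
      fin_cases i <;> simp
    · exact ⟨0, by simpa using hw⟩
  | one => exact ⟨0, by simp⟩
  | mul a b _ _ pa pb =>
    obtain ⟨e, he⟩ := pa
    obtain ⟨f, hf⟩ := pb
    refine ⟨e + f, ?_⟩
    rw [QuotientGroup.mk_mul, he, hf]
    simp only [Pi.add_apply, zpow_add]
    generalize ((z 0 ^ 3 ^ n : G) : G ⧸ Q.lowerCubeSeries (n + 1)) = u0 at *
    generalize ((z 1 ^ 3 ^ n : G) : G ⧸ Q.lowerCubeSeries (n + 1)) = u1 at *
    generalize ((z 2 ^ 3 ^ n : G) : G ⧸ Q.lowerCubeSeries (n + 1)) = u2 at *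
    calc u0 ^ e 0 * u1 ^ e 1 * u2 ^ e 2 * (u0 ^ f 0 * u1 ^ f 1 * u2 ^ f 2)
        = u0 ^ e 0 * u1 ^ e 1 * (u2 ^ e 2 * u0 ^ f 0) * u1 ^ f 1 * u2 ^ f 2 := by
          simp only [mul_assoc]
      _ = u0 ^ e 0 * (u1 ^ e 1 * u0 ^ f 0) * (u2 ^ e 2 * u1 ^ f 1) * u2 ^ f 2 := by
          rw [← h02]; simp only [mul_assoc]
      _ = _ := by rw [← h01, ← h12]; simp only [mul_assoc]
  | inv a _ pa =>
    obtain ⟨e, he⟩ := pa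
    refine ⟨-e, ?_⟩
    rw [QuotientGroup.mk_inv, he]
    simp only [Pi.neg_apply, mul_inv_rev, ← zpow_neg]
    rw [h01, mul_assoc, h02, ← mul_assoc, ← mul_assoc, h12]

end

end Subgroup

/-! ### The congruence filtration of SL₂(ℤ₃) and first-order expansions. -/

namespace SchurSigma

open Matrix

/-- The congruence subgroup of level `3 ^ k` of `SL₂(ℤ₃)`. -/
noncomputable def congr (k : ℕ) : Subgroup (SpecialLinearGroup (Fin 2) ℤ_[3]) :=
  (SpecialLinearGroup.map (PadicInt.toZModPow k)).ker

instance (k : ℕ) : (congr k).Normal := MonoidHom.normal_ker _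

instance (k : ℕ) : (congr k).FiniteIndex := Subgroup.finiteIndex_ker _

theorem toZModPow_eq_zero_iff {k : ℕ} {a : ℤ_[3]} :
    PadicInt.toZModPow k a = 0 ↔ (3 : ℤ_[3]) ^ k ∣ a := by
  rw [← RingHom.mem_ker, PadicInt.ker_toZModPow, Ideal.mem_span_singleton]
  norm_num

theorem mem_congr_iff_dvd {k : ℕ} {g : SpecialLinearGroup (Fin 2) ℤ_[3]} :
    g ∈ congr k ↔ ∀ i j, (3 : ℤ_[3]) ^ k ∣ g i j - (1 : Matrix (Fin 2) (Fin 2) ℤ_[3]) i j := by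
  rw [congr, MonoidHom.mem_ker, Matrix.SpecialLinearGroup.ext_iff]
  refine forall₂_congr fun i j => ?_
  rw [← toZModPow_eq_zero_iff, map_sub, sub_eq_zero, Matrix.one_apply, Matrix.SpecialLinearGroup.coe_one,
    Matrix.one_apply, apply_ite (PadicInt.toZModPow k), map_one, map_zero]
  rfl

theorem mem_congr_iff {k : ℕ} {g : SpecialLinearGroup (Fin 2) ℤ_[3]} :
    g ∈ congr k ↔ ∃ A : Matrix (Fin 2) (Fin 2) ℤ_[3],
      (g : Matrix (Fin 2) (Fin 2) ℤ_[3]) = 1 + (3 : ℤ_[3]) ^ k • A := by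
  rw [mem_congr_iff_dvd]
  constructor
  · intro h
    choose A hA using h
    refine ⟨Matrix.of A, ?_⟩
    ext i j
    rw [Matrix.add_apply, Matrix.smul_apply, Matrix.of_apply, smul_eq_mul, ← hA]
    ring
  · rintro ⟨A, hA⟩ i j
    refine ⟨A i j, ?_⟩
    rw [hA, Matrix.add_apply, Matrix.smul_apply, smul_eq_mul]
    ring

theorem congr_antitone : Antitone congr := fun k l h g hg => by
  rw [mem_congr_iff_dvd] at hg ⊢
  exact fun i j => (pow_dvd_pow 3 h).trans (hg i j)

theorem eq_one_of_forall_mem_congr {g : SpecialLinearGroup (Fin 2) ℤ_[3]}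
    (h : ∀ k, g ∈ congr k) : g = 1 := by
  ext i j
  refine PadicInt.ext_of_toZModPow.1 fun k => ?_
  have h1 := mem_congr_iff_dvd.1 (h k) i j
  rwa [← toZModPow_eq_zero_iff, map_sub, sub_eq_zero] at h1

theorem isOpen_congr (k : ℕ) :
    IsOpen (congr k : Set (SpecialLinearGroup (Fin 2) ℤ_[3])) := by
  have h : (congr k : Set (SpecialLinearGroup (Fin 2) ℤ_[3])) =
      ⋂ i, ⋂ j, (fun g => g i j - (1 : Matrix (Fin 2) (Fin 2) ℤ_[3]) i j) ⁻¹'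
        Metric.closedBall 0 ((3 : ℝ) ^ (-k : ℤ)) := by
    ext g
    simp only [SetLike.mem_coe, mem_congr_iff_dvd, Set.mem_iInter, Set.mem_preimage,
      mem_closedBall_zero_iff]
    refine forall₂_congr fun i j => ?_
    have := PadicInt.norm_le_pow_iff_mem_span_pow (p := 3)
      (g i j - (1 : Matrix (Fin 2) (Fin 2) ℤ_[3]) i j) k
    rw [Ideal.mem_span_singleton] at this
    exact_mod_cast this.symm
  rw [h]
  refine isOpen_iInter_of_finite fun i => isOpen_iInter_of_finite fun j => ?_
  refine (IsUltrametricDist.isOpen_closedBall _ (by positivity)).preimage ?_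
  fun_prop

instance : CompactSpace (SpecialLinearGroup (Fin 2) ℤ_[3]) :=
  have : CompactSpace (Matrix (Fin 2) (Fin 2) ℤ_[3]) :=
    inferInstanceAs (CompactSpace (Fin 2 → Fin 2 → ℤ_[3]))
  SpecialLinearGroup.isClosedEmbedding_val.compactSpace

/-- `g` is congruent to `1 + 3 ^ k A` modulo `3 ^ (k + 1)`. -/
def FirstOrder (k : ℕ) (g : SpecialLinearGroup (Fin 2) ℤ_[3])
    (A : Matrix (Fin 2) (Fin 2) ℤ_[3]) : Prop :=
  ∃ B : Matrix (Fin 2) (Fin 2) ℤ_[3], (g : Matrix (Fin 2) (Fin 2) ℤ_[3]) =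
    1 + (3 : ℤ_[3]) ^ k • A + (3 : ℤ_[3]) ^ (k + 1) • B

namespace FirstOrder

variable {k : ℕ} {g h : SpecialLinearGroup (Fin 2) ℤ_[3]} {A A' : Matrix (Fin 2) (Fin 2) ℤ_[3]}

theorem mem_congr (hg : FirstOrder k g A) : g ∈ congr k := by
  obtain ⟨B, hB⟩ := hg
  exact mem_congr_iff.2 ⟨A + (3 : ℤ_[3]) • B, by rw [hB]; module⟩

theorem one : FirstOrder k 1 0 := ⟨0, by simp⟩

/-- The cross term carries 3^(2k+2), which is divisible by 3^(k+2); this is why the level must be at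
least 1. -/
theorem mul (hg : FirstOrder (k + 1) g A) (hh : FirstOrder (k + 1) h A') :
    FirstOrder (k + 1) (g * h) (A + A') := by
  obtain ⟨B, hB⟩ := hg
  obtain ⟨B', hB'⟩ := hh
  refine ⟨B + B' + (3 : ℤ_[3]) ^ k • ((A + (3 : ℤ_[3]) • B) * (A' + (3 : ℤ_[3]) • B')), ?_⟩
  rw [Matrix.SpecialLinearGroup.coe_mul, hB, hB']
  simp only [add_mul, mul_add, smul_mul_assoc, mul_smul_comm, one_mul, mul_one]
  module

theorem inv (hg : FirstOrder (k + 1) g A) : FirstOrder (k + 1) g⁻¹ (-A) := by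
  obtain ⟨C, hC⟩ := mem_congr_iff.1 (inv_mem hg.mem_congr)
  obtain ⟨B, hB⟩ := hg
  have h1 : (g : Matrix (Fin 2) (Fin 2) ℤ_[3]) * (g⁻¹ : SpecialLinearGroup (Fin 2) ℤ_[3]) = 1 := by
    rw [← Matrix.SpecialLinearGroup.coe_mul, mul_inv_cancel, Matrix.SpecialLinearGroup.coe_one]
  refine ⟨-B - (3 : ℤ_[3]) ^ k • ((A + (3 : ℤ_[3]) • B) * C), ?_⟩
  have h2 : ((g⁻¹ : SpecialLinearGroup (Fin 2) ℤ_[3]) : Matrix (Fin 2) (Fin 2) ℤ_[3]) =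
    1 + (g⁻¹ : SpecialLinearGroup (Fin 2) ℤ_[3]) - (g : Matrix (Fin 2) (Fin 2) ℤ_[3]) *
      (g⁻¹ : SpecialLinearGroup (Fin 2) ℤ_[3]) := by rw [h1]; abel
  rw [h2, hB, hC]
  simp only [add_mul, mul_add, smul_mul_assoc, mul_smul_comm, one_mul, mul_one]
  module

theorem npow (hg : FirstOrder (k + 1) g A) (n : ℕ) :
    FirstOrder (k + 1) (g ^ n) ((n : ℤ_[3]) • A) := by
  induction n with
  | zero => simpa using one
  | succ n ih =>
    rw [pow_succ, Nat.cast_succ, add_smul, one_smul]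
    exact ih.mul hg

theorem zpow (hg : FirstOrder (k + 1) g A) (n : ℤ) :
    FirstOrder (k + 1) (g ^ n) ((n : ℤ_[3]) • A) := by
  obtain ⟨n, rfl | rfl⟩ := n.eq_nat_or_neg
  · simpa using hg.npow n
  · simpa using (hg.npow n).inv

/-- In (1 + 3^(k+1)D)³ the linear term is 3^(k+2)D, while the quadratic and cubic terms carry
3^(2k+3) and 3^(3k+3), both divisible by 3^(k+3). -/
theorem pow_three (hg : FirstOrder (k + 1) g A) : FirstOrder (k + 2) (g ^ 3) A := by
  obtain ⟨B, hB⟩ := hg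
  have hB' : (g : Matrix (Fin 2) (Fin 2) ℤ_[3]) =
    1 + (3 : ℤ_[3]) ^ (k + 1) • (A + (3 : ℤ_[3]) • B) := by rw [hB]; module
  refine ⟨B + (3 : ℤ_[3]) ^ k • ((A + (3 : ℤ_[3]) • B) * (A + (3 : ℤ_[3]) • B)) +
    (3 : ℤ_[3]) ^ (2 * k) • ((A + (3 : ℤ_[3]) • B) * (A + (3 : ℤ_[3]) • B) *
      (A + (3 : ℤ_[3]) • B)), ?_⟩
  rw [Matrix.SpecialLinearGroup.coe_pow, hB', pow_succ, pow_two]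
  have hA : A = (A + (3 : ℤ_[3]) • B) - (3 : ℤ_[3]) • B := by abel
  generalize A + (3 : ℤ_[3]) • B = D at *
  subst hA
  simp only [add_mul, mul_add, smul_mul_assoc, mul_smul_comm, one_mul, mul_one]
  module

theorem pow_three_pow (hg : FirstOrder 1 g A) (n : ℕ) : FirstOrder (n + 1) (g ^ 3 ^ n) A := by
  induction n with
  | zero => simpa using hg
  | succ n ih => rw [pow_succ, pow_mul]; exact ih.pow_three

theorem dvd_of_mem (hg : FirstOrder k g A) (hk : g ∈ congr (k + 1)) (i j : Fin 2) :
    (3 : ℤ_[3]) ∣ A i j := by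
  obtain ⟨B, hB⟩ := hg
  obtain ⟨c, hc⟩ := mem_congr_iff_dvd.1 hk i j
  refine ⟨c - B i j, ?_⟩
  have h3 : (3 : ℤ_[3]) ^ k ≠ 0 := pow_ne_zero _ (by norm_num)
  refine mul_left_cancel₀ h3 ?_
  rw [hB] at hc
  simp only [Matrix.add_apply, Matrix.smul_apply, smul_eq_mul] at hc
  linear_combination hc

theorem inv_mul_mem (hg : FirstOrder (k + 1) g A) (hh : FirstOrder (k + 1) h A')
    (hA : ∀ i j, (3 : ℤ_[3]) ∣ A' i j - A i j) : g⁻¹ * h ∈ congr (k + 2) := by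
  obtain ⟨B, hB⟩ := hg.inv.mul hh
  refine mem_congr_iff_dvd.2 fun i j => ?_
  obtain ⟨c, hc⟩ := hA i j
  refine ⟨c + B i j, ?_⟩
  rw [hB]
  simp only [Matrix.add_apply, Matrix.smul_apply, Matrix.neg_apply, smul_eq_mul]
  linear_combination (3 : ℤ_[3]) ^ (k + 1) * hc

end FirstOrder

theorem pow_three_mem_congr {k : ℕ} {g : SpecialLinearGroup (Fin 2) ℤ_[3]}
    (hg : g ∈ congr (k + 1)) : g ^ 3 ∈ congr (k + 2) := by
  obtain ⟨A, hA⟩ := mem_congr_iff.1 hg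
  exact (FirstOrder.pow_three ⟨0, by rw [hA]; simp⟩ : FirstOrder (k + 2) (g ^ 3) A).mem_congr

/-- The constant and linear parts cancel in gh − hg, leaving 3^(k+2)(AB − BA); multiply by g⁻¹h⁻¹ on
the right. -/
theorem commutator_mem_congr {k : ℕ} {g h : SpecialLinearGroup (Fin 2) ℤ_[3]}
    (hg : g ∈ congr (k + 1)) (hh : h ∈ congr 1) : ⁅g, h⁆ ∈ congr (k + 2) := by
  obtain ⟨A, hA⟩ := mem_congr_iff.1 hg
  obtain ⟨B, hB⟩ := mem_congr_iff.1 hh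
  refine mem_congr_iff.2 ⟨(A * B - B * A) * ((g⁻¹ * h⁻¹ : SpecialLinearGroup (Fin 2) ℤ_[3]) :
    Matrix (Fin 2) (Fin 2) ℤ_[3]), ?_⟩
  have h1 : ((h * g : SpecialLinearGroup (Fin 2) ℤ_[3]) : Matrix (Fin 2) (Fin 2) ℤ_[3]) *
      (g⁻¹ * h⁻¹ : SpecialLinearGroup (Fin 2) ℤ_[3]) = 1 := by
    rw [← Matrix.SpecialLinearGroup.coe_mul, show h * g * (g⁻¹ * h⁻¹) = 1 by group,
      Matrix.SpecialLinearGroup.coe_one]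
  have h2 : ((g * h : SpecialLinearGroup (Fin 2) ℤ_[3]) : Matrix (Fin 2) (Fin 2) ℤ_[3]) =
      (h * g : SpecialLinearGroup (Fin 2) ℤ_[3]) + (3 : ℤ_[3]) ^ (k + 2) • (A * B - B * A) := by
    rw [Matrix.SpecialLinearGroup.coe_mul, Matrix.SpecialLinearGroup.coe_mul, hA, hB]
    simp only [add_mul, mul_add, smul_mul_assoc, mul_smul_comm, one_mul, mul_one]
    module
  rw [commutatorElement_def, mul_assoc, Matrix.SpecialLinearGroup.coe_mul, h2, add_mul, h1,
    smul_mul_assoc]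

end SchurSigma

/-! ### Normal subgroups of prime-power index. -/

theorem Subgroup.index_comap_eq_pow_of_pow_mem {G : Type*} [Group G] (N : Subgroup G) [N.Normal]
    [N.FiniteIndex] (p : ℕ) [Fact p.Prime] (h : ∀ g : G, ∃ k : ℕ, g ^ p ^ k ∈ N) :
    ∃ k : ℕ, N.index = p ^ k := by
  have hp : IsPGroup p (G ⧸ N) := fun g => by
    obtain ⟨g, rfl⟩ := QuotientGroup.mk_surjective g
    obtain ⟨k, hk⟩ := h g
    exact ⟨k, by rw [← QuotientGroup.mk_pow]; exact (QuotientGroup.eq_one_iff _).2 hk⟩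
  rw [Subgroup.index_eq_card]
  exact IsPGroup.iff_card.1 hp

/-- A normal subgroup of `3`-power index contains a term of each lower exponent-`3` central
series. -/
theorem Subgroup.exists_lowerCubeSeries_le {G : Type*} [Group G] (Q : Subgroup G) (m : ℕ)
    (N : Subgroup G) [N.Normal] (hN : N.index = 3 ^ m) : ∃ k, Q.lowerCubeSeries k ≤ N := by
  induction m using Nat.strong_induction_on generalizing N with
  | _ m ih =>
  by_cases htop : N = ⊤
  · exact ⟨0, htop ▸ le_top⟩
  have hfin : N.FiniteIndex := ⟨by rw [hN]; positivity⟩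
  have hcard : Nat.card (G ⧸ N) = 3 ^ m := by rw [← Subgroup.index_eq_card, hN]
  have hp : IsPGroup 3 (G ⧸ N) := IsPGroup.of_card hcard
  have hnt : Nontrivial (G ⧸ N) := by
    rw [QuotientGroup.nontrivial_iff]; exact htop
  have := hp.center_nontrivial
  obtain ⟨j, hj0, hj⟩ := (hp.to_subgroup (Subgroup.center (G ⧸ N))).nontrivial_iff_card.1 this
  -- A central element c of order 3 in the quotient enlarges N to the preimage N' of ⟨c⟩. If a term
  -- of the series lies in N', its cubes and its commutators with Q lie in N, so the next term does
  -- too.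
  obtain ⟨c, hc⟩ := exists_prime_orderOf_dvd_card' (G := Subgroup.center (G ⧸ N)) 3
    (hj ▸ dvd_pow_self 3 hj0.ne')
  have hcc : ∀ g : G ⧸ N, Commute (c : G ⧸ N) g := fun g => (Subgroup.mem_center_iff.1 c.2 g).symm
  have hc3 : (c : G ⧸ N) ^ 3 = 1 := by
    rw [← hc, ← Subgroup.orderOf_coe, pow_orderOf_eq_one]
  have hc1 : (c : G ⧸ N) ≠ 1 := fun h => by
    rw [← Subgroup.orderOf_coe, h, orderOf_one] at hc; omega
  have hnorm : (Subgroup.zpowers (c : G ⧸ N)).Normal := ⟨fun a ha g => by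
    obtain ⟨i, rfl⟩ := ha
    rw [← ((hcc g).zpow_left i).eq, mul_inv_cancel_right]
    exact ⟨i, rfl⟩⟩
  set N' := (Subgroup.zpowers (c : G ⧸ N)).comap (QuotientGroup.mk' N) with hN'
  have hlt : N < N' := by
    refine lt_of_le_of_ne (fun g hg => ?_) fun h => hc1 ?_
    · rw [hN', Subgroup.mem_comap, QuotientGroup.mk'_apply, (QuotientGroup.eq_one_iff g).2 hg]
      exact one_mem _
    · obtain ⟨g, hg⟩ := QuotientGroup.mk_surjective (c : G ⧸ N)
      rw [← hg, QuotientGroup.eq_one_iff, h, hN', Subgroup.mem_comap, QuotientGroup.mk'_apply, hg]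
      exact Subgroup.mem_zpowers _
  obtain ⟨l, hl, hl'⟩ := (Nat.dvd_prime_pow Nat.prime_three).1
    (hN ▸ Subgroup.index_dvd_of_le hlt.le)
  have hlm : l < m := by
    refine lt_of_le_of_ne hl fun h => ?_
    have := Subgroup.index_strictAnti hlt
    rw [hl', hN, h] at this
    exact lt_irrefl _ this
  obtain ⟨k, hk⟩ := ih l hlm N' hl'
  refine ⟨k + 1, Subgroup.lowerCubeSeries_succ_le_iff.2 ⟨fun w hw => ?_, fun w hw q _ => ?_⟩⟩ <;>
  obtain ⟨i, hi⟩ := hk hw <;> rw [← QuotientGroup.eq_one_iff] <;>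
  change (c : G ⧸ N) ^ i = (w : G ⧸ N) at hi
  · rw [QuotientGroup.mk_pow, ← hi, ← zpow_natCast, ← zpow_mul, mul_comm, zpow_mul]
    rw [zpow_natCast, hc3, one_zpow]
  · change ⁅(w : G ⧸ N), (q : G ⧸ N)⁆ = 1
    rw [← hi, commutatorElement_eq_one_iff_commute]
    exact (hcc _).zpow_left i

/-! ### The discrete group: its series is the pullback of the congruence filtration. -/

namespace SchurSigma

open Subgroup

variable {Γ : Type*} [Group Γ]

/-- The three conjugates of `y * x⁻¹` under `x`, where `x ^ 3 = 1`. -/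
def gens (x y : Γ) : Fin 3 → Γ := ![y * x ^ 2, x * y * x, x ^ 2 * y]

/-- Generators `x`, `y` of a group which satisfy the relations of `H`, together with a
representation mapping them to the given matrices. -/
structure IsModel (x y : Γ) (ρ : Γ →* Matrix.SpecialLinearGroup (Fin 2) ℤ_[3]) (α : ℤ_[3]) : Prop where
  closure_eq : closure {x, y} = ⊤
  pow_three : x ^ 3 = 1
  rel : y * x * y * x⁻¹ * y = y⁻¹ * x⁻¹ * y⁻¹ * x * y⁻¹
  map_x : (ρ x : Matrix (Fin 2) (Fin 2) ℤ_[3]) = !![0, -1; 1, -1]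
  map_y : (ρ y : Matrix (Fin 2) (Fin 2) ℤ_[3]) = α • !![0, half; 1, -1]
  sq : α ^ 2 = -2
  dvd : (3 : ℤ_[3]) ∣ α - 1

/-- The relation gives ba = a⁻²b⁻², whence ⁅b, a⁆ = a⁻²b⁻³a⁻¹, a conjugate of b⁻³ times a⁻³. -/
theorem commutator_mem_closure_cubes {Q : Subgroup Γ} {a b : Γ} (ha : a ∈ Q) (hb : b ∈ Q)
    (h : b * a * b ^ 2 * a ^ 2 = 1) : ⁅b, a⁆ ∈ closure {c | ∃ w ∈ Q, w ^ 3 = c} := by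
  have h1 : ⁅b, a⁆ = (a⁻¹ ^ 2 * b⁻¹ * a ^ 2) ^ 3 * a⁻¹ ^ 3 := by
    have h2 : b * a = (b ^ 2 * a ^ 2)⁻¹ := by rw [eq_inv_iff_mul_eq_one, ← h, mul_assoc (b * a)]
    rw [commutatorElement_def, h2]
    simp only [pow_succ, pow_zero]
    group
  rw [h1]
  exact mul_mem (subset_closure ⟨_, mul_mem (mul_mem (pow_mem (inv_mem ha) 2) (inv_mem hb))
    (pow_mem ha 2), rfl⟩) (subset_closure ⟨_, inv_mem ha, rfl⟩)

/-- The coefficients of `3` in the matrices of the `gens x y`. -/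
noncomputable def genMatrix (i : Fin 3) : Matrix (Fin 2) (Fin 2) ℤ_[3] :=
  ![!![-1, 0; 0, 1], !![1, 0; -1, -1], !![1, 1; 0, -1]] i

theorem three_dvd_intCast {n : ℤ} : (3 : ℤ_[3]) ∣ n ↔ (3 : ℤ) ∣ n := by
  have := PadicInt.norm_int_lt_one_iff_dvd (p := 3) n
  rw [PadicInt.norm_lt_one_iff_dvd] at this
  exact_mod_cast this

theorem exists_int_dvd_sub (a : ℤ_[3]) : ∃ n : ℤ, (3 : ℤ_[3]) ∣ a - n := by
  refine ⟨a.zmodRepr, ?_⟩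
  have := a.sub_zmodRepr_mem
  rw [PadicInt.maximalIdeal_eq_span_p, Ideal.mem_span_singleton] at this
  exact_mod_cast this

namespace IsModel

variable {x y : Γ} {ρ : Γ →* Matrix.SpecialLinearGroup (Fin 2) ℤ_[3]} {α : ℤ_[3]}

theorem inv_x (h : IsModel x y ρ α) : x⁻¹ = x ^ 2 := by
  rw [inv_eq_iff_mul_eq_one, ← pow_succ', h.pow_three]

theorem conj_gens (h : IsModel x y ρ α) (i : Fin 3) : x * gens x y i * x⁻¹ = gens x y (i + 1) := by
  have h3 := h.pow_three
  fin_cases i <;> simp only [gens] <;> simp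
  · rw [pow_two]; group
  · rw [h.inv_x, show x * (x * y * x) * x ^ 2 = x ^ 2 * y * x ^ 3 by
      simp only [pow_succ, pow_zero]; group, h3, mul_one]
  · rw [h.inv_x, show x * (x ^ 2 * y) * x ^ 2 = x ^ 3 * (y * x ^ 2) by
      simp only [pow_succ, pow_zero]; group, h3, one_mul]

/-- Conjugation by x permutes the generators cyclically, and y = z₀x with z₀ in the subgroup. -/
theorem normal (h : IsModel x y ρ α) : (closure (Set.range (gens x y))).Normal := by
  rw [← normalizer_eq_top_iff, eq_top_iff, ← h.closure_eq, closure_le]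
  have hc : ∀ q ∈ closure (Set.range (gens x y)), x * q * x⁻¹ ∈ closure (Set.range (gens x y)) := by
    intro q hq
    have : closure (Set.range (gens x y)) ≤
        (closure (Set.range (gens x y))).comap (MulAut.conj x).toMonoidHom := by
      rw [closure_le]
      rintro _ ⟨i, rfl⟩
      change x * gens x y i * x⁻¹ ∈ closure (Set.range (gens x y))
      rw [h.conj_gens]
      exact subset_closure ⟨_, rfl⟩
    exact this hq
  have hx : x ∈ normalizer (closure (Set.range (gens x y)) : Set Γ) := by
    rw [mem_normalizer_iff]
    refine fun q => ⟨hc q, fun hq => ?_⟩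
    have h1 := hc _ (hc _ hq)
    have h2 : x * (x * (x * q * x⁻¹) * x⁻¹) * x⁻¹ = x ^ 3 * q * (x ^ 3)⁻¹ := by
      simp only [pow_succ, pow_zero]; group
    rwa [h2, h.pow_three, one_mul, inv_one, mul_one] at h1
  rintro w (hw | hw)
  · rw [hw]; exact hx
  · rw [Set.mem_singleton_iff.1 hw]
    have h1 : gens x y 0 * x ∈ normalizer (closure (Set.range (gens x y)) : Set Γ) :=
      mul_mem (le_normalizer (subset_closure ⟨0, rfl⟩)) hx
    have h2 : gens x y 0 * x = y := by
      change y * x ^ 2 * x = y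
      rw [mul_assoc, ← pow_succ, h.pow_three, mul_one]
    rwa [h2] at h1

theorem exists_eq_mul_zpow (h : IsModel x y ρ α) (g : Γ) :
    ∃ q ∈ closure (Set.range (gens x y)), ∃ i : ℤ, g = q * x ^ i := by
  have := h.normal
  have htop : closure (Set.range (gens x y)) ⊔ zpowers x = ⊤ := by
    rw [eq_top_iff, ← h.closure_eq, closure_le]
    have hx : x ∈ closure (Set.range (gens x y)) ⊔ zpowers x :=
      (le_sup_right : zpowers x ≤ _) (mem_zpowers x)
    rintro w (hw | hw)
    · rw [hw]; exact hx
    · rw [Set.mem_singleton_iff.1 hw]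
      have h1 : gens x y 0 * x ∈ closure (Set.range (gens x y)) ⊔ zpowers x :=
        mul_mem ((le_sup_left : closure (Set.range (gens x y)) ≤ _) (subset_closure ⟨0, rfl⟩)) hx
      have h2 : gens x y 0 * x = y := by
        change y * x ^ 2 * x = y
        rw [mul_assoc, ← pow_succ, h.pow_three, mul_one]
      rwa [h2] at h1
  obtain ⟨q, hq, _, ⟨i, rfl⟩, rfl⟩ := mem_sup_of_normal_left.1 (htop ▸ mem_top g)
  exact ⟨q, hq, i, rfl⟩

theorem gens_rel (h : IsModel x y ρ α) (i : Fin 3) :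
    gens x y i * gens x y (i + 1) * gens x y i ^ 2 * gens x y (i + 1) ^ 2 = 1 := by
  -- This case is the relation t = σ(t) rewritten using x³ = 1; conjugating it by x yields the other
  -- two.
  have h2 : gens x y 2 * gens x y 0 * gens x y 2 ^ 2 * gens x y 0 ^ 2 = 1 := by
    change x ^ 2 * y * (y * x ^ 2) * (x ^ 2 * y) ^ 2 * (y * x ^ 2) ^ 2 = 1
    calc _ = x ^ 2 * y * y * x ^ 3 * (x * y * x ^ 2 * y * y * x ^ 2 * y * x ^ 2) := by
          simp only [pow_succ, pow_zero]; group
      _ = x⁻¹ * y * (y * x * y * x⁻¹ * y) * (y * x⁻¹ * y * x⁻¹) := by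
          rw [h.pow_three, ← h.inv_x]; group
      _ = (x ^ 3)⁻¹ := by rw [h.rel]; simp only [pow_succ, pow_zero]; group
      _ = 1 := by rw [h.pow_three, inv_one]
  have hstep : ∀ i : Fin 3, gens x y i * gens x y (i + 1) * gens x y i ^ 2 *
      gens x y (i + 1) ^ 2 = 1 → gens x y (i + 1) * gens x y (i + 1 + 1) *
      gens x y (i + 1) ^ 2 * gens x y (i + 1 + 1) ^ 2 = 1 := fun i hi => by
    have := congrArg (fun w => x * w * x⁻¹) hi
    simp only [mul_one, mul_inv_cancel] at this
    rw [show ∀ a b : Γ, x * (a * b * a ^ 2 * b ^ 2) * x⁻¹ = x * a * x⁻¹ * (x * b * x⁻¹) *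
      (x * a * x⁻¹) ^ 2 * (x * b * x⁻¹) ^ 2 from fun a b => by
        simp only [pow_succ, pow_zero]; group] at this
    rwa [h.conj_gens, h.conj_gens] at this
  have h0 := hstep 2 h2
  fin_cases i
  exacts [h0, hstep 0 h0, h2]

theorem commutator_gens_mem (h : IsModel x y ρ α) (i j : Fin 3) : ⁅gens x y i, gens x y j⁆ ∈
    closure {a | ∃ w ∈ closure (Set.range (gens x y)), w ^ 3 = a} := by
  have hz : ∀ i, gens x y i ∈ closure (Set.range (gens x y)) := fun i => subset_closure ⟨i, rfl⟩
  have hs : ∀ i : Fin 3, ⁅gens x y i, gens x y (i + 1)⁆ ∈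
      closure {a | ∃ w ∈ closure (Set.range (gens x y)), w ^ 3 = a} :=
    fun i => commutator_mem_closure_cubes (hz _) (hz _) (h.gens_rel i)
  have hij : j = i ∨ j = i + 1 ∨ i = j + 1 := by decide +revert
  obtain rfl | rfl | rfl := hij
  · rw [commutatorElement_self]; exact one_mem _
  · exact hs i
  · rw [← inv_mem_iff, commutatorElement_inv]; exact hs j

theorem firstOrder_gens (h : IsModel x y ρ α) (i : Fin 3) :
    FirstOrder 1 (ρ (gens x y i)) (genMatrix i) := by
  obtain ⟨u, hu⟩ := h.dvd
  -- Put α = 1 + 3u. Then α² = −2 becomes 1 + 2u + 3u² = 0, which determines α modulo 9. It follows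
  -- that −α/2 ≡ 7 modulo 9, and these two residues give every first-order coefficient, since z₀
  -- maps to diag(−α/2, α).
  have hα : α = 4 + 9 * (u + u ^ 2) := by
    have h3 : (3 : ℤ_[3]) * (1 + 2 * u + 3 * u ^ 2) = 0 := by
      have := h.sq
      rw [show α = 1 + 3 * u by linear_combination hu] at this
      linear_combination this
    have h4 : 1 + 2 * u + 3 * u ^ 2 = 0 := (mul_eq_zero.1 h3).resolve_left (by norm_num)
    linear_combination hu - 3 * h4
  generalize u + u ^ 2 = b at hα
  obtain ⟨c, hc⟩ : ∃ c, -(α * half) = 7 + 9 * c :=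
    ⟨4 * half - 5 * b + 9 * b * half - 3, by
      linear_combination (-half) * hα + (-20 - 45 * b) * two_mul_half⟩
  have hX := h.map_x
  have hY := h.map_y
  fin_cases i
  · refine ⟨!![1 + c, 0; 0, b], ?_⟩
    change ((ρ (y * x ^ 2) : Matrix.SpecialLinearGroup (Fin 2) ℤ_[3]) : Matrix (Fin 2) (Fin 2) ℤ_[3]) = _
    rw [pow_two, map_mul, map_mul, Matrix.SpecialLinearGroup.coe_mul,
      Matrix.SpecialLinearGroup.coe_mul, hX, hY]
    ext i j
    fin_cases i <;> fin_cases j <;> simp [genMatrix, Matrix.mul_apply, Fin.sum_univ_two]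
    · linear_combination hc
    · linear_combination hα
  · refine ⟨!![b, 0; b - c, 1 + c], ?_⟩
    change ((ρ (x * y * x) : Matrix.SpecialLinearGroup (Fin 2) ℤ_[3]) : Matrix (Fin 2) (Fin 2) ℤ_[3]) = _
    rw [map_mul, map_mul, Matrix.SpecialLinearGroup.coe_mul,
      Matrix.SpecialLinearGroup.coe_mul, hX, hY]
    ext i j
    fin_cases i <;> fin_cases j <;> simp [genMatrix, Matrix.mul_apply, Fin.sum_univ_two]
    · linear_combination hα
    · linear_combination hα - hc
    · linear_combination hc
  · refine ⟨!![b, c - b; 0, 1 + c], ?_⟩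
    change ((ρ (x ^ 2 * y) : Matrix.SpecialLinearGroup (Fin 2) ℤ_[3]) : Matrix (Fin 2) (Fin 2) ℤ_[3]) = _
    rw [pow_two, map_mul, map_mul, Matrix.SpecialLinearGroup.coe_mul,
      Matrix.SpecialLinearGroup.coe_mul, hX, hY]
    ext i j
    fin_cases i <;> fin_cases j <;> simp [genMatrix, Matrix.mul_apply, Fin.sum_univ_two]
    · linear_combination hα
    · linear_combination hc - hα
    · linear_combination hc

theorem firstOrder_prod (h : IsModel x y ρ α) (n : ℕ) (e : Fin 3 → ℤ) :
    FirstOrder (n + 1) (ρ ((gens x y 0 ^ 3 ^ n) ^ e 0 * (gens x y 1 ^ 3 ^ n) ^ e 1 *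
      (gens x y 2 ^ 3 ^ n) ^ e 2))
      !![-(e 0 : ℤ_[3]) + e 1 + e 2, e 2; -e 1, e 0 - e 1 - e 2] := by
  have hf : ∀ i, FirstOrder (n + 1) (ρ ((gens x y i ^ 3 ^ n) ^ e i))
      ((e i : ℤ_[3]) • genMatrix i) := fun i => by
    rw [map_zpow, map_pow]
    exact ((h.firstOrder_gens i).pow_three_pow n).zpow (e i)
  convert ((hf 0).mul (hf 1)).mul (hf 2) using 1
  · simp only [map_mul]
  · ext i j
    fin_cases i <;> fin_cases j <;> simp [genMatrix]
    ring

theorem map_mem_congr (h : IsModel x y ρ α) (n : ℕ) {g : Γ}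
    (hg : g ∈ (closure (Set.range (gens x y))).lowerCubeSeries n) : ρ g ∈ congr (n + 1) := by
  have h0 : closure (Set.range (gens x y)) ≤ (congr 1).comap ρ := by
    rw [closure_le]
    rintro _ ⟨i, rfl⟩
    exact (h.firstOrder_gens i).mem_congr
  suffices (closure (Set.range (gens x y))).lowerCubeSeries n ≤ (congr (n + 1)).comap ρ from
    this hg
  clear hg
  induction n with
  | zero => exact h0
  | succ n ih =>
    refine lowerCubeSeries_succ_le_iff.2 ⟨fun w hw => ?_, fun w hw q hq => ?_⟩
    · rw [mem_comap, map_pow]; exact pow_three_mem_congr (ih hw)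
    · rw [mem_comap, map_commutatorElement]; exact commutator_mem_congr (ih hw) (h0 hq)

/-- Write g = qxⁱ with q in the subgroup. Neither x nor x² maps to the identity modulo 3, as an
off-diagonal entry equals 1, so 3 divides i. -/
theorem mem_closure_gens (h : IsModel x y ρ α) {g : Γ} (hg : ρ g ∈ congr 1) :
    g ∈ closure (Set.range (gens x y)) := by
  obtain ⟨q, hq, i, rfl⟩ := h.exists_eq_mul_zpow g
  have hxi : x ^ i = x ^ (i % 3) := by
    conv_lhs => rw [← Int.emod_add_mul_ediv i 3, zpow_add, zpow_mul]
    rw [zpow_ofNat, h.pow_three, one_zpow, mul_one]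
  rw [map_mul] at hg
  have hi : ρ (x ^ (i % 3)) ∈ congr 1 := by
    rw [← hxi]
    exact (mul_mem_cancel_left (h.map_mem_congr 0 hq)).1 hg
  rw [hxi]
  have h3 : i % 3 = 0 ∨ i % 3 = 1 ∨ i % 3 = 2 := by omega
  have hn : ¬ (3 : ℤ_[3]) ∣ 1 := fun hd => by
    have := (three_dvd_intCast (n := 1)).1 (by simpa using hd)
    omega
  obtain h3 | h3 | h3 := h3 <;> rw [h3] at hi ⊢
  · simpa using hq
  · have := mem_congr_iff_dvd.1 hi 1 0
    rw [zpow_one, h.map_x] at this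
    exact absurd (by simpa using this) hn
  · have := mem_congr_iff_dvd.1 hi 0 1
    rw [zpow_ofNat, pow_two, map_mul, Matrix.SpecialLinearGroup.coe_mul,
      h.map_x] at this
    exact absurd (by simpa using this) hn

/-- The terms of the lower exponent-`3` central series are the preimages of the congruence
subgroups. -/
theorem map_mem_congr_iff (h : IsModel x y ρ α) (n : ℕ) {g : Γ} :
    ρ g ∈ congr (n + 1) ↔ g ∈ (closure (Set.range (gens x y))).lowerCubeSeries n := by
  refine ⟨fun hg => ?_, h.map_mem_congr n⟩
  have := h.normal
  induction n with
  | zero => exact h.mem_closure_gens hg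
  | succ n ih =>
    have hz : ∀ i, gens x y i ∈ closure (Set.range (gens x y)) := fun i => subset_closure ⟨i, rfl⟩
    have hgn := lowerCubeSeries_le_powSup rfl h.commutator_gens_mem n
      (ih (congr_antitone (Nat.le_succ _) hg))
    obtain ⟨e, he⟩ := exists_zpow_mul_zpow_mul_zpow hz hgn
    have hle : (closure (Set.range (gens x y))).lowerCubeSeries (n + 1) ≤
      (congr (n + 2)).comap ρ := fun g => h.map_mem_congr (n + 1)
    -- The first-order coefficient e₀A₀ + e₁A₁ + e₂A₂ vanishes modulo 3. Independence of the Aᵢ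
    -- makes every eᵢ divisible by 3, so each factor falls into the next term.
    have hd := (h.firstOrder_prod n e).dvd_of_mem ((mem_iff_of_mk_eq hle he).1 hg)
    have h2 : (3 : ℤ_[3]) ∣ e 2 := by simpa using hd 0 1
    have h1 : (3 : ℤ_[3]) ∣ e 1 := by simpa using hd 1 0
    have h0 : (3 : ℤ_[3]) ∣ e 0 := by
      have := (dvd_add (hd 1 1) (dvd_add h1 h2))
      simp at this
      ring_nf at this
      exact this
    have hi : ∀ i, (gens x y i ^ 3 ^ n) ^ e i ∈
        (closure (Set.range (gens x y))).lowerCubeSeries (n + 1) := fun i => by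
      have hi : (3 : ℤ_[3]) ∣ e i := by fin_cases i <;> assumption
      obtain ⟨f, hf⟩ := three_dvd_intCast.1 hi
      rw [hf, zpow_mul]
      refine zpow_mem ?_ f
      rw [zpow_ofNat]
      exact pow_three_mem_lowerCubeSeries (pow_three_pow_mem_lowerCubeSeries (hz i) n)
    exact (mem_iff_of_mk_eq le_rfl he).2 (mul_mem (mul_mem (hi 0) (hi 1)) (hi 2))

/-- Every cube lies in Q, and 3ᵏ-th powers of elements of Q lie in term k; so the finite quotient is
a 3-group. -/
theorem exists_index_comap_congr (h : IsModel x y ρ α) (k : ℕ) :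
    ∃ m, ((congr k).comap ρ).index = 3 ^ m := by
  have : ((congr k).comap ρ).FiniteIndex := by
    rw [congr, MonoidHom.comap_ker]; exact finiteIndex_ker _
  refine index_comap_eq_pow_of_pow_mem _ 3 fun g => ⟨k + 1, ?_⟩
  have := h.normal
  have h3 : g ^ 3 ∈ closure (Set.range (gens x y)) := by
    obtain ⟨q, hq, i, rfl⟩ := h.exists_eq_mul_zpow g
    rw [← QuotientGroup.eq_one_iff] at hq ⊢
    rw [QuotientGroup.mk_pow, QuotientGroup.mk_mul, hq, one_mul, ← QuotientGroup.mk_pow,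
      ← zpow_natCast, ← zpow_mul, mul_comm, zpow_mul]
    rw [zpow_natCast, h.pow_three, one_zpow, QuotientGroup.mk_one]
  rw [pow_succ', pow_mul]
  exact congr_antitone (Nat.le_succ k)
    (h.map_mem_congr k (pow_three_pow_mem_lowerCubeSeries h3 k))

theorem exists_comap_congr_le (h : IsModel x y ρ α) (N : Subgroup Γ) [N.Normal] {m : ℕ}
    (hN : N.index = 3 ^ m) : ∃ k, (congr k).comap ρ ≤ N := by
  obtain ⟨k, hk⟩ := exists_lowerCubeSeries_le (closure (Set.range (gens x y))) m N hN
  exact ⟨k + 1, fun g hg => hk ((h.map_mem_congr_iff k).1 hg)⟩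

theorem exists_inv_mul_mem_succ (h : IsModel x y ρ α) {n : ℕ}
    {g : Matrix.SpecialLinearGroup (Fin 2) ℤ_[3]} (hg : g ∈ congr (n + 1)) :
    ∃ w, (ρ w)⁻¹ * g ∈ congr (n + 2) := by
  obtain ⟨A, hA⟩ := mem_congr_iff.1 hg
  obtain ⟨a, ha⟩ := exists_int_dvd_sub (A 0 0)
  obtain ⟨b, hb⟩ := exists_int_dvd_sub (A 0 1)
  obtain ⟨c, hc⟩ := exists_int_dvd_sub (A 1 0)
  -- Expanding det(1 + 3^(n+1)A) = 1 shows that the trace of A vanishes modulo 3.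
  have htr : (3 : ℤ_[3]) ∣ A 0 0 + A 1 1 := by
    have hdet := g.2
    rw [hA, Matrix.det_fin_two] at hdet
    simp only [Matrix.add_apply, Matrix.smul_apply, smul_eq_mul, Matrix.one_apply_eq,
      Matrix.one_apply_ne (show (0 : Fin 2) ≠ 1 by decide),
      Matrix.one_apply_ne (show (1 : Fin 2) ≠ 0 by decide), zero_add] at hdet
    have h3 : (3 : ℤ_[3]) ^ (n + 1) ≠ 0 := pow_ne_zero _ (by norm_num)
    refine ⟨-(3 ^ n * (A 0 0 * A 1 1 - A 0 1 * A 1 0)), mul_left_cancel₀ h3 ?_⟩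
    linear_combination hdet
  -- These exponents solve e₂ = b, −e₁ = c, −e₀ + e₁ + e₂ = a; the remaining entry is handled by the
  -- trace.
  refine ⟨_, (h.firstOrder_prod n ![-c + b - a, -c, b]).inv_mul_mem
    ⟨0, by rw [hA]; simp⟩ (A' := A) fun i j => ?_⟩
  fin_cases i <;> fin_cases j <;> simp
  · convert ha using 1; ring
  · exact hb
  · exact hc
  · convert dvd_sub htr ha using 1; ring

theorem exists_inv_mul_mem (h : IsModel x y ρ α) {g : Matrix.SpecialLinearGroup (Fin 2) ℤ_[3]}
    (hg : g ∈ congr 1) (n : ℕ) : ∃ w, (ρ w)⁻¹ * g ∈ congr (n + 1) := by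
  induction n with
  | zero => exact ⟨1, by simpa using hg⟩
  | succ n ih =>
    obtain ⟨w, hw⟩ := ih
    obtain ⟨v, hv⟩ := h.exists_inv_mul_mem_succ hw
    exact ⟨w * v, by rw [map_mul, mul_inv_rev, mul_assoc]; exact hv⟩

end IsModel

end SchurSigma

/-! ### Compactness and topology of pro-p completions. -/

theorem Subgroup.exists_le_of_isOpen {S : Type*} [Group S] [TopologicalSpace S] [CompactSpace S]
    {U : ℕ → Subgroup S} (hclosed : ∀ k, IsClosed (U k : Set S)) (hanti : Antitone U)
    (hinf : ∀ s, (∀ k, s ∈ U k) → s = 1) {V : Set S} (hV : IsOpen V) (h1 : 1 ∈ V) :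
    ∃ k, (U k : Set S) ⊆ V := by
  refine exists_subset_nhds_of_isCompact' (fun i j => ⟨max i j, hanti (le_max_left i j),
    hanti (le_max_right i j)⟩) (fun k => (hclosed k).isCompact) hclosed fun s hs => ?_
  rw [hinf s fun k => Set.mem_iInter.1 hs k]
  exact hV.mem_nhds h1

namespace PPowerNormalSubgroup

variable {p : ℕ} {G : Type*} [Group G]

theorem mk_surjective (N : PPowerNormalSubgroup p G) : Function.Surjective N.mk :=
  QuotientGroup.mk'_surjective _

theorem mk_eq_mk_iff {N : PPowerNormalSubgroup p G} {a b : G} :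
    N.mk a = N.mk b ↔ a⁻¹ * b ∈ N.1 :=
  QuotientGroup.eq

variable [Fact p.Prime]

instance (N : PPowerNormalSubgroup p G) : N.1.FiniteIndex := ⟨by
  obtain ⟨k, hk⟩ := N.2.2
  rw [hk]
  exact pow_ne_zero _ (Fact.out : p.Prime).ne_zero⟩

instance (N : PPowerNormalSubgroup p G) : Finite N.Quot :=
  inferInstanceAs (Finite (G ⧸ N.1))

/-- A normal subgroup that contains one of `p`-power index. -/
def ofLE (N : PPowerNormalSubgroup p G) (M : Subgroup G) [M.Normal] (h : N.1 ≤ M) :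
    PPowerNormalSubgroup p G :=
  ⟨M, inferInstance, by
    obtain ⟨k, hk⟩ := N.2.2
    obtain ⟨m, -, hm⟩ := (Nat.dvd_prime_pow (Fact.out : p.Prime)).1
      (hk ▸ Subgroup.index_dvd_of_le h)
    exact ⟨m, hm⟩⟩

theorem exists_le_le (N M : PPowerNormalSubgroup p G) :
    ∃ K : PPowerNormalSubgroup p G, K.1 ≤ N.1 ∧ K.1 ≤ M.1 := by
  refine ⟨⟨N.1 ⊓ M.1, inferInstance, ?_⟩, inf_le_left, inf_le_right⟩
  obtain ⟨k, hk⟩ := N.2.2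
  obtain ⟨l, hl⟩ := M.2.2
  have h : (N.1 ⊓ M.1).index ∣ p ^ (l + k) := by
    rw [← Subgroup.relIndex_mul_index (inf_le_left : N.1 ⊓ M.1 ≤ N.1), Subgroup.inf_relIndex_left,
      pow_add, ← hk, ← hl]
    exact mul_dvd_mul_right (Subgroup.relIndex_dvd_index_of_normal _ _) _
  obtain ⟨m, -, hm⟩ := (Nat.dvd_prime_pow (Fact.out : p.Prime)).1 h
  exact ⟨m, hm⟩

theorem exists_forall_le (I : Finset (PPowerNormalSubgroup p G)) :
    ∃ K : PPowerNormalSubgroup p G, ∀ N ∈ I, K.1 ≤ N.1 := by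
  classical
  induction I using Finset.induction_on with
  | empty => exact ⟨⟨⊤, inferInstance, 0, by simp⟩, by simp⟩
  | insert N I _ ih =>
    obtain ⟨K, hK⟩ := ih
    obtain ⟨L, hN, hL⟩ := exists_le_le N K
    refine ⟨L, fun M hM => ?_⟩
    obtain rfl | hM := Finset.mem_insert.1 hM
    exacts [hN, hL.trans (hK M hM)]

end PPowerNormalSubgroup

namespace ProPCompletion

variable {p : ℕ} {G : Type*} [Group G]

theorem mk_eq_of_le {f : ProPCompletion p G} {N M : PPowerNormalSubgroup p G} (h : N.1 ≤ M.1)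
    {w : G} (hw : N.mk w = f.1 N) : M.mk w = f.1 M := by
  rw [← f.2 N M h, ← hw]
  rfl

theorem exists_mk_eq (f : ProPCompletion p G) (N : PPowerNormalSubgroup p G) :
    ∃ w, N.mk w = f.1 N :=
  N.mk_surjective (f.1 N)

/-- The projection to a finite quotient. -/
def proj (N : PPowerNormalSubgroup p G) : ProPCompletion p G →* N.Quot where
  toFun f := f.1 N
  map_one' := rfl
  map_mul' _ _ := rfl

theorem isClosed : IsClosed
    (proPCompletionSubgroup p G : Set (∀ N : PPowerNormalSubgroup p G, N.Quot)) := by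
  have h : (proPCompletionSubgroup p G : Set (∀ N : PPowerNormalSubgroup p G, N.Quot)) =
      ⋂ (N : PPowerNormalSubgroup p G) (M : PPowerNormalSubgroup p G) (h : N.1 ≤ M.1),
        {f | PPowerNormalSubgroup.trans h (f N) = f M} := by
    ext f
    simp only [Set.mem_iInter]
    rfl
  rw [h]
  refine isClosed_iInter fun N => isClosed_iInter fun M => isClosed_iInter fun h => ?_
  exact isClosed_eq (continuous_of_discreteTopology.comp (continuous_apply N)) (continuous_apply M)

section Extend

variable {S : Type*} [Group S] [TopologicalSpace S] [IsTopologicalGroup S] [CompactSpace S]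

/-- A homomorphism `φ` to a compact group that is an inverse limit of quotients by open normal
subgroups `U k` extends to the pro-`p` completion if the preimages of the `U k` have `p`-power
index. -/
theorem exists_extend (φ : G →* S) (U : ℕ → Subgroup S) [∀ k, (U k).Normal]
    (hopen : ∀ k, IsOpen (U k : Set S)) (hanti : Antitone U)
    (hinf : ∀ s, (∀ k, s ∈ U k) → s = 1) (N : ℕ → PPowerNormalSubgroup p G)
    (hN : ∀ k, (N k).1 = (U k).comap φ) :
    ∃ ρ : ProPCompletion p G →ₜ* S, (∀ g, ρ (of p G g) = φ g) ∧
      ∀ f k w, (N k).mk w = f.1 (N k) → (ρ f)⁻¹ * φ w ∈ U k := by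
  have hclosed : ∀ k, IsClosed (U k : Set S) := fun k => (U k).isClosed_of_isOpen (hopen k)
  have hN' : ∀ k w, w ∈ (N k).1 ↔ φ w ∈ U k := fun k w => by rw [hN]; rfl
  have hle : ∀ k l, k ≤ l → (N l).1 ≤ (N k).1 := fun k l h w hw =>
    (hN' k w).2 (hanti h ((hN' l w).1 hw))
  have hex : ∀ f : ProPCompletion p G, ∃ s : S, ∀ k w, (N k).mk w = f.1 (N k) →
      s⁻¹ * φ w ∈ U k := fun f => by
    choose w hw using fun k => exists_mk_eq f (N k)
    have hmem : ∀ k u v, (N k).mk u = f.1 (N k) → (N k).mk v = f.1 (N k) →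
        ∀ s, s⁻¹ * φ u ∈ U k → s⁻¹ * φ v ∈ U k := by
      intro k u v hu hv s hs
      have h1 : u⁻¹ * v ∈ (N k).1 := PPowerNormalSubgroup.mk_eq_mk_iff.1 (hu.trans hv.symm)
      have h2 := mul_mem hs ((hN' k _).1 h1)
      rwa [map_mul, map_inv, mul_assoc, mul_inv_cancel_left] at h2
    -- The cosets φ(wₖ)Uₖ are nested, closed and nonempty, so by compactness they have a common
    -- point, which serves as the value at f.
    obtain ⟨s, hs⟩ := IsCompact.nonempty_iInter_of_sequence_nonempty_isCompact_isClosed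
      (fun k => {s : S | s⁻¹ * φ (w k) ∈ U k})
      (fun k s hs => hmem k _ _ (mk_eq_of_le (hle k (k + 1) (Nat.le_succ k)) (hw (k + 1)))
        (hw k) s (hanti (Nat.le_succ k) hs))
      (fun k => ⟨φ (w k), by simp⟩) ((hclosed 0).preimage (by fun_prop)).isCompact
      fun k => (hclosed k).preimage (by fun_prop)
    exact ⟨s, fun k v hv => hmem k _ v (hw k) hv s (Set.mem_iInter.1 hs k)⟩
  choose r hr using hex
  -- As the Uₖ meet trivially, one good representative at each level pins down the value;
  -- multiplicativity follows from this.
  have huniq : ∀ f s, (∀ k, ∃ w, (N k).mk w = f.1 (N k) ∧ s⁻¹ * φ w ∈ U k) → r f = s := by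
    intro f s h
    rw [← inv_mul_eq_one]
    refine hinf _ fun k => ?_
    obtain ⟨w, hw, hs⟩ := h k
    have := mul_mem (hr f k w hw) (inv_mem hs)
    simpa [mul_assoc] using this
  have hof : ∀ g, r (of p G g) = φ g := fun g => huniq _ _ fun k => ⟨g, rfl, by simp⟩
  let ρ : ProPCompletion p G →* S :=
    { toFun := r
      map_one' := huniq _ _ fun k => ⟨1, map_one _, by simp⟩
      map_mul' := fun a b => huniq _ _ fun k => by
        obtain ⟨v, hv⟩ := exists_mk_eq a (N k)
        obtain ⟨w, hw⟩ := exists_mk_eq b (N k)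
        refine ⟨v * w, by rw [map_mul, hv, hw]; rfl, ?_⟩
        have h1 := (inferInstance : (U k).Normal).conj_mem _ (hr a k v hv) (r b)⁻¹
        have h2 := mul_mem h1 (hr b k w hw)
        simpa [mul_assoc] using h2 }
  refine ⟨⟨ρ, continuous_of_continuousAt_one ρ ?_⟩, hof, hr⟩
  rw [ContinuousAt, map_one]
  intro V hV
  obtain ⟨V', hV', hVo, h1⟩ := mem_nhds_iff.1 hV
  obtain ⟨k, hk⟩ := Subgroup.exists_le_of_isOpen hclosed hanti hinf hVo h1
  have hopen' : IsOpen ({f | f.1 (N k) = 1} : Set (ProPCompletion p G)) :=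
    (isOpen_discrete ({1} : Set (N k).Quot)).preimage
      ((continuous_apply (N k)).comp continuous_subtype_val)
  refine Filter.mem_map.2 (Filter.mem_of_superset (hopen'.mem_nhds rfl) fun f hf => hV' (hk ?_))
  change r f ∈ U k
  simpa using hr f k 1 ((map_one _).trans hf.symm)

end Extend

variable [Fact p.Prime]

instance : CompactSpace (ProPCompletion p G) :=
  isCompact_iff_compactSpace.1 isClosed.isCompact

/-- A basic open set of the product restricts finitely many coordinates, and a single smaller normal
subgroup controls them all. -/
theorem exists_forall_mem_of_isOpen {O : Set (ProPCompletion p G)} (hO : IsOpen O)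
    {f : ProPCompletion p G} (hf : f ∈ O) :
    ∃ K : PPowerNormalSubgroup p G, ∀ s : ProPCompletion p G, s.1 K = f.1 K → s ∈ O := by
  obtain ⟨V, hV, rfl⟩ := isOpen_induced_iff.1 hO
  obtain ⟨I, u, hu, hI⟩ := isOpen_pi_iff.1 hV f.1 hf
  obtain ⟨K, hK⟩ := PPowerNormalSubgroup.exists_forall_le I
  refine ⟨K, fun s hs => hI fun N hN => ?_⟩
  rw [← s.2 K N (hK N hN), hs, f.2 K N (hK N hN)]
  exact (hu N hN).2

theorem mem_closure_of_forall {S : Set (ProPCompletion p G)} {f : ProPCompletion p G}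
    (h : ∀ K : PPowerNormalSubgroup p G, ∃ s ∈ S, s.1 K = f.1 K) : f ∈ closure S := by
  refine mem_closure_iff.2 fun O hO hf => ?_
  obtain ⟨K, hK⟩ := exists_forall_mem_of_isOpen hO hf
  obtain ⟨s, hs, hsK⟩ := h K
  exact ⟨s, hK s hsK, hs⟩

theorem denseRange_of : DenseRange (of p G) := fun f => mem_closure_of_forall fun K => by
  obtain ⟨w, hw⟩ := exists_mk_eq f K
  exact ⟨_, ⟨w, rfl⟩, hw⟩

theorem exists_index_eq_of_isOpen (M : Subgroup (ProPCompletion p G))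
    (hM : IsOpen (M : Set (ProPCompletion p G))) : ∃ k : ℕ, M.index = p ^ k := by
  obtain ⟨K, hK⟩ := exists_forall_mem_of_isOpen hM (one_mem M)
  have hle : (proj K).ker ≤ M := fun f hf => hK f hf
  have hsurj : Function.Surjective (proj K) := fun a => by
    obtain ⟨w, rfl⟩ := K.mk_surjective a
    exact ⟨of p G w, rfl⟩
  obtain ⟨k, hk⟩ := K.2.2
  have hker : (proj K).ker.index = p ^ k := by
    rw [Subgroup.index_ker, MonoidHom.range_eq_top.2 hsurj, ← hk, Subgroup.index_eq_card]
    exact Nat.card_congr Subgroup.topEquiv.toEquiv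
  obtain ⟨m, -, hm⟩ := (Nat.dvd_prime_pow (Fact.out : p.Prime)).1
    (hker ▸ Subgroup.index_dvd_of_le hle)
  exact ⟨m, hm⟩

end ProPCompletion

/-! ### The matrix representation and its extension to the free pro-3 group. -/

namespace SchurSigma

open Subgroup

/-- The matrix of `x`. -/
noncomputable def matX : Matrix.SpecialLinearGroup (Fin 2) ℤ_[3] :=
  ⟨!![0, -1; 1, -1], by simp [Matrix.det_fin_two]⟩

/-- The matrix of `y`. -/
noncomputable def matY (α : ℤ_[3]) (hα : α ^ 2 = -2) : Matrix.SpecialLinearGroup (Fin 2) ℤ_[3] :=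
  ⟨α • !![0, half; 1, -1], by
    simp only [Matrix.det_smul, Matrix.det_fin_two, Fintype.card_fin, Matrix.of_apply,
      Matrix.cons_val', Matrix.cons_val_zero, Matrix.cons_val_one, Matrix.cons_val_fin_one]
    linear_combination (-half) * hα + two_mul_half⟩

theorem matX_pow_three : matX ^ 3 = 1 := by
  refine Subtype.ext ?_
  rw [Matrix.SpecialLinearGroup.coe_pow, Matrix.SpecialLinearGroup.coe_one]
  change !![0, -1; 1, -1] ^ 3 = 1
  simp [pow_succ, Matrix.one_fin_two]

theorem mat_rel {α : ℤ_[3]} (hα : α ^ 2 = -2) :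
    matY α hα * matX * matY α hα * matX⁻¹ * matY α hα =
      (matY α hα)⁻¹ * matX⁻¹ * (matY α hα)⁻¹ * matX * (matY α hα)⁻¹ := by
  have hX : (matX : Matrix (Fin 2) (Fin 2) ℤ_[3]) = !![0, -1; 1, -1] := rfl
  have hY : (matY α hα : Matrix (Fin 2) (Fin 2) ℤ_[3]) = !![0, α * half; α, -α] := by
    change α • !![0, half; 1, -1] = _
    simp
  refine Subtype.ext ?_
  simp only [Matrix.SpecialLinearGroup.coe_mul, Matrix.SpecialLinearGroup.coe_inv, hX, hY,
    Matrix.adjugate_fin_two_of, Matrix.mul_fin_two]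
  ext i j
  fin_cases i <;> fin_cases j <;> simp
  · ring
  · linear_combination (-(α ^ 3 * half * (1 + half))) * two_mul_half

/-- The relators of `H` in the free group. -/
def relators : Set (FreeGroup (Fin 2)) :=
  {FreeGroup.of 0 ^ 3, (FreeGroup.of 1 * FreeGroup.of 0 * FreeGroup.of 1 * (FreeGroup.of 0)⁻¹ *
    FreeGroup.of 1)⁻¹ * ((FreeGroup.of 1)⁻¹ * (FreeGroup.of 0)⁻¹ * (FreeGroup.of 1)⁻¹ *
      FreeGroup.of 0 * (FreeGroup.of 1)⁻¹)}

/-- The representation of the free group. -/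
noncomputable def freeRep (α : ℤ_[3]) (hα : α ^ 2 = -2) :
    FreeGroup (Fin 2) →* Matrix.SpecialLinearGroup (Fin 2) ℤ_[3] :=
  FreeGroup.lift ![matX, matY α hα]

section

variable {α : ℤ_[3]} (hα : α ^ 2 = -2)

theorem freeRep_x : freeRep α hα (FreeGroup.of 0) = matX := by simp [freeRep]

theorem freeRep_y : freeRep α hα (FreeGroup.of 1) = matY α hα := by simp [freeRep]

theorem normalClosure_relators_le : normalClosure relators ≤ (freeRep α hα).ker := by
  refine normalClosure_le_normal ?_
  rintro w (hw | hw)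
  · rw [hw, SetLike.mem_coe, MonoidHom.mem_ker, map_pow, freeRep_x, matX_pow_three]
  · rw [Set.mem_singleton_iff.1 hw, SetLike.mem_coe, MonoidHom.mem_ker]
    simp only [map_mul, map_inv, freeRep_x, freeRep_y]
    rw [inv_mul_eq_one]
    exact mat_rel hα

/-- The representation of the abstract group with the presentation of `H`. -/
noncomputable def discreteRep :
    FreeGroup (Fin 2) ⧸ normalClosure relators →* Matrix.SpecialLinearGroup (Fin 2) ℤ_[3] :=
  QuotientGroup.lift _ (freeRep α hα) (normalClosure_relators_le hα)

theorem isModel (hα₁ : (3 : ℤ_[3]) ∣ α - 1) : IsModel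
    ((FreeGroup.of 0 : FreeGroup (Fin 2)) : FreeGroup (Fin 2) ⧸ normalClosure relators)
    ((FreeGroup.of 1 : FreeGroup (Fin 2)) : FreeGroup (Fin 2) ⧸ normalClosure relators)
    (discreteRep hα) α where
  closure_eq := by
    have h : (closure (Set.range (FreeGroup.of : Fin 2 → FreeGroup (Fin 2)))).map
        (QuotientGroup.mk' (normalClosure relators)) = ⊤ := by
      rw [FreeGroup.closure_range_of, ← MonoidHom.range_eq_map]
      exact MonoidHom.range_eq_top.2 (QuotientGroup.mk'_surjective _)
    rw [eq_top_iff, ← h, MonoidHom.map_closure, closure_le]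
    rintro _ ⟨_, ⟨i, rfl⟩, rfl⟩
    refine subset_closure ?_
    fin_cases i
    exacts [Or.inl rfl, Or.inr rfl]
  pow_three := by
    rw [← QuotientGroup.mk_pow, QuotientGroup.eq_one_iff]
    exact subset_normalClosure (Or.inl rfl)
  rel := by
    simp only [← QuotientGroup.mk_inv, ← QuotientGroup.mk_mul]
    rw [QuotientGroup.eq]
    exact subset_normalClosure (Or.inr rfl)
  map_x := congrArg Subtype.val (freeRep_x hα)
  map_y := congrArg Subtype.val (freeRep_y hα)
  sq := hα
  dvd := hα₁

variable (hα₁ : (3 : ℤ_[3]) ∣ α - 1)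
include hα₁

theorem exists_index_comap_freeRep (k : ℕ) : ∃ m, ((congr k).comap (freeRep α hα)).index = 3 ^ m := by
  obtain ⟨m, hm⟩ := (isModel hα hα₁).exists_index_comap_congr k
  refine ⟨m, ?_⟩
  rw [← hm, ← index_comap_of_surjective _ (QuotientGroup.mk'_surjective (normalClosure relators))]
  rfl

theorem exists_comap_freeRep_le (N : Subgroup (FreeGroup (Fin 2))) [N.Normal]
    (hR : normalClosure relators ≤ N) {m : ℕ} (hN : N.index = 3 ^ m) :
    ∃ k, (congr k).comap (freeRep α hα) ≤ N := by
  have hs := QuotientGroup.mk'_surjective (normalClosure relators)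
  have hcm : (N.map (QuotientGroup.mk' (normalClosure relators))).comap
      (QuotientGroup.mk' (normalClosure relators)) = N :=
    comap_map_eq_self (by rwa [QuotientGroup.ker_mk'])
  have := Normal.map ‹N.Normal› _ hs
  obtain ⟨k, hk⟩ := (isModel hα hα₁).exists_comap_congr_le
    (N.map (QuotientGroup.mk' (normalClosure relators))) (m := m)
    (by rw [← index_comap_of_surjective _ hs, hcm, hN])
  refine ⟨k, fun g hg => ?_⟩
  rw [← hcm]
  exact hk hg

/-- The subgroups of the free group that are preimages of the congruence subgroups. -/
noncomputable def congrComap (k : ℕ) : PPowerNormalSubgroup 3 (FreeGroup (Fin 2)) :=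
  ⟨(congr k).comap (freeRep α hα), inferInstance, exists_index_comap_freeRep hα hα₁ k⟩

theorem exists_inv_mul_mem_freeRep {g : Matrix.SpecialLinearGroup (Fin 2) ℤ_[3]}
    (hg : g ∈ congr 1) (n : ℕ) : ∃ w, (freeRep α hα w)⁻¹ * g ∈ congr (n + 1) := by
  obtain ⟨w, hw⟩ := (isModel hα hα₁).exists_inv_mul_mem hg n
  obtain ⟨w, rfl⟩ := QuotientGroup.mk_surjective w
  exact ⟨w, hw⟩

end

theorem image_relators :
    ProPCompletion.of 3 (FreeGroup (Fin 2)) '' relators = {x ^ 3, t⁻¹ * σ t} := by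
  rw [relators, Set.image_pair]
  simp only [t, map_mul, map_inv, map_pow, σ_x, σ_y, inv_inv]
  rfl

theorem isClosed_congr (k : ℕ) :
    IsClosed (congr k : Set (Matrix.SpecialLinearGroup (Fin 2) ℤ_[3])) :=
  (congr k).isClosed_of_isOpen (isOpen_congr k)

/-- The representation of the free pro-`3` group, and its kernel. -/
theorem exists_rep_F {α : ℤ_[3]} (hα : α ^ 2 = -2) (hα₁ : (3 : ℤ_[3]) ∣ α - 1) :
    ∃ ρ : F →ₜ* Matrix.SpecialLinearGroup (Fin 2) ℤ_[3],
      (∀ g, ρ (ProPCompletion.of 3 _ g) = freeRep α hα g) ∧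
      (ρ : F →* Matrix.SpecialLinearGroup (Fin 2) ℤ_[3]).ker =
        (normalClosure {x ^ 3, t⁻¹ * σ t}).topologicalClosure := by
  obtain ⟨ρ, hof, hρ⟩ := ProPCompletion.exists_extend (freeRep α hα) congr isOpen_congr
    congr_antitone (fun _ => eq_one_of_forall_mem_congr) (congrComap hα hα₁) fun _ => rfl
  refine ⟨ρ, hof, le_antisymm (fun f hf => ?_) ?_⟩
  · refine ProPCompletion.mem_closure_of_forall fun N => ?_
    -- Only subgroups containing the relators are controlled by congruence subgroups, so N is first
    -- enlarged by their normal closure.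
    obtain ⟨k, hk⟩ := exists_comap_freeRep_le hα hα₁
      (N.ofLE (normalClosure relators ⊔ N.1) le_sup_right).1 le_sup_left
      (N.ofLE (normalClosure relators ⊔ N.1) le_sup_right).2.2.choose_spec
    -- A word w that agrees with f at L also agrees with it at N, and its image is trivial modulo
    -- 3ᵏ. Hence w = rn with r in the normal closure of the relators and n in N, and r approximates
    -- f at N.
    obtain ⟨L, hLN, hLk⟩ := N.exists_le_le (congrComap hα hα₁ k)
    obtain ⟨w, hw⟩ := f.exists_mk_eq L
    have hwk := hρ f k w (ProPCompletion.mk_eq_of_le hLk hw)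
    rw [show ρ f = 1 from hf, inv_one, one_mul] at hwk
    obtain ⟨r, hr, n, hn, rfl⟩ := mem_sup_of_normal_left.1 (hk hwk)
    refine ⟨ProPCompletion.of 3 _ r, ?_, ?_⟩
    · have hle : normalClosure relators ≤ (normalClosure {x ^ 3, t⁻¹ * σ t}).comap
          (ProPCompletion.of 3 (FreeGroup (Fin 2))) := by
        refine normalClosure_le_normal fun w hw => ?_
        rw [← image_relators]
        exact subset_normalClosure ⟨w, hw, rfl⟩
      exact hle hr
    · rw [← ProPCompletion.mk_eq_of_le hLN hw]
      exact PPowerNormalSubgroup.mk_eq_mk_iff.2 (by simpa using hn)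
  · refine topologicalClosure_minimal _ (normalClosure_le_normal ?_)
      (isClosed_singleton.preimage ρ.continuous_toFun)
    rw [← image_relators]
    rintro _ ⟨w, hw, rfl⟩
    change ρ _ = 1
    rw [hof]
    exact normalClosure_relators_le hα (subset_normalClosure hw)

/-! ### The Sylow property, uniqueness and the isomorphism. -/

theorem card_specialLinearGroup_zmod_three :
    Nat.card (Matrix.SpecialLinearGroup (Fin 2) (ZMod (3 ^ 1))) = 24 := by
  rw [Nat.card_eq_fintype_card]
  decide +kernel

/-- Modulo 3 the index becomes that of a subgroup of order divisible by 3 in a group of order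
dividing 24, and 9 does not divide 24. -/
theorem coprime_index {P : Subgroup (Matrix.SpecialLinearGroup (Fin 2) ℤ_[3])} (hP : congr 1 ≤ P)
    (hX : matX ∈ P) : Nat.Coprime 3 P.index := by
  set m : Matrix.SpecialLinearGroup (Fin 2) ℤ_[3] →*
    Matrix.SpecialLinearGroup (Fin 2) (ZMod (3 ^ 1)) :=
    Matrix.SpecialLinearGroup.map (PadicInt.toZModPow 1)
  have h1 : P.index = (P.map m).relIndex m.range := by
    rw [← index_comap, comap_map_eq_self hP]
  have h2 : Nat.card ((P.map m).subgroupOf m.range) * (P.map m).relIndex m.range =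
    Nat.card m.range := card_mul_index _
  have h3 : Nat.card m.range ∣ 24 := card_specialLinearGroup_zmod_three ▸ card_subgroup_dvd_card _
  have hle : P.map m ≤ m.range := map_le_range m P
  have h4 : 3 ∣ Nat.card ((P.map m).subgroupOf m.range) := by
    rw [Nat.card_congr (subgroupOfEquivOfLe hle).toEquiv]
    have h5 : orderOf (m matX) = 3 := by
      refine orderOf_eq_prime (by rw [← map_pow, matX_pow_three, map_one]) fun h => ?_
      have h6 := mem_congr_iff_dvd.1 (show matX ∈ congr 1 from h) 1 0
      have h7 : (3 : ℤ_[3]) ∣ ((1 : ℤ) : ℤ_[3]) := by simpa [matX] using h6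
      have := three_dvd_intCast.1 h7
      omega
    exact h5.symm.dvd.trans <| Subgroup.orderOf_dvd_natCard _ (mem_map_of_mem m hX)
  rw [h1, (Nat.prime_three).coprime_iff_not_dvd]
  intro h
  have := (mul_dvd_mul h4 h).trans (h2.dvd.trans h3)
  omega

/-- Images of words approximate each element of level 3 to any precision, and `P` is closed. -/
theorem congr_one_le {α : ℤ_[3]} (hα : α ^ 2 = -2) (hα₁ : (3 : ℤ_[3]) ∣ α - 1)
    {P : Subgroup (Matrix.SpecialLinearGroup (Fin 2) ℤ_[3])}
    (hP : IsClosed (P : Set (Matrix.SpecialLinearGroup (Fin 2) ℤ_[3])))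
    (hle : ∀ w, freeRep α hα w ∈ P) : congr 1 ≤ P := by
  intro g hg
  by_contra hgP
  obtain ⟨k, hk⟩ := exists_le_of_isOpen isClosed_congr congr_antitone
    (fun _ => eq_one_of_forall_mem_congr)
    (hP.isOpen_compl.preimage (continuous_const_mul g)) (by simpa using hgP)
  obtain ⟨w, hw⟩ := exists_inv_mul_mem_freeRep hα hα₁ hg k
  have h1 := hk (inv_mem (congr_antitone (Nat.le_succ k) hw))
  rw [mul_inv_rev, inv_inv] at h1
  exact h1 (by simpa using hle w)

instance : TotallyDisconnectedSpace (Matrix.SpecialLinearGroup (Fin 2) ℤ_[3]) :=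
  have : TotallyDisconnectedSpace (Matrix (Fin 2) (Fin 2) ℤ_[3]) :=
    inferInstanceAs (TotallyDisconnectedSpace (Fin 2 → Fin 2 → ℤ_[3]))
  inferInstanceAs (TotallyDisconnectedSpace (Subtype _))

/-- Open normal subgroups of the image pull back to open subgroups of F with the same index, which
is a power of 3. -/
theorem isProPSylow_range {α : ℤ_[3]} (hα : α ^ 2 = -2) (hα₁ : (3 : ℤ_[3]) ∣ α - 1)
    {ρ : F →ₜ* Matrix.SpecialLinearGroup (Fin 2) ℤ_[3]}
    (hof : ∀ g, ρ (ProPCompletion.of 3 _ g) = freeRep α hα g)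
    {P : Subgroup (Matrix.SpecialLinearGroup (Fin 2) ℤ_[3])}
    (hP : ∀ g, g ∈ P ↔ ∃ f, ρ f = g) : IsProPSylow 3 P := by
  have hclosed : IsClosed (P : Set (Matrix.SpecialLinearGroup (Fin 2) ℤ_[3])) := by
    have : (P : Set (Matrix.SpecialLinearGroup (Fin 2) ℤ_[3])) = Set.range ρ := Set.ext hP
    rw [this]
    exact (isCompact_range ρ.continuous_toFun).isClosed
  refine ⟨hclosed, ⟨inferInstance, isCompact_iff_compactSpace.1 hclosed.isCompact, inferInstance,
    inferInstance, fun N _ hN => ?_⟩, fun U _ hU => ?_⟩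
  · let ρP : F →* P := (ρ : F →* Matrix.SpecialLinearGroup (Fin 2) ℤ_[3]).codRestrict P
      fun f => (hP _).2 ⟨f, rfl⟩
    have hs : Function.Surjective ρP := fun ⟨g, hg⟩ => by
      obtain ⟨f, hf⟩ := (hP g).1 hg
      exact ⟨f, Subtype.ext hf⟩
    have hc : Continuous ρP := ρ.continuous_toFun.subtype_mk _
    rw [← index_comap_of_surjective N hs]
    exact ProPCompletion.exists_index_eq_of_isOpen _ (hN.preimage hc)
  · have hle : ∀ w, freeRep α hα w ∈ P := fun w => (hP _).2 ⟨_, hof w⟩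
    have h := coprime_index (congr_one_le hα hα₁ hclosed hle)
      (freeRep_x hα ▸ hle (FreeGroup.of 0))
    exact Nat.Coprime.coprime_dvd_right (index_dvd_of_le hU) h

/-- The words in the two generators are dense in H, and the target is Hausdorff. -/
theorem hom_ext {S : Type*} [Group S] [TopologicalSpace S] [T2Space S] {ρ ρ' : H →ₜ* S}
    (hx : ρ xH = ρ' xH) (hy : ρ yH = ρ' yH) : ρ = ρ' := by
  have hd : DenseRange fun g => ((ProPCompletion.of 3 (FreeGroup (Fin 2)) g : F) : H) :=
    (QuotientGroup.mk_surjective.denseRange).comp ProPCompletion.denseRange_of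
      QuotientGroup.continuous_mk
  have h : (ρ : H →* S).comp ((QuotientGroup.mk' _).comp (ProPCompletion.of 3 (FreeGroup (Fin 2)))) =
      (ρ' : H →* S).comp ((QuotientGroup.mk' _).comp (ProPCompletion.of 3 (FreeGroup (Fin 2)))) := by
    refine FreeGroup.ext_hom _ _ fun i => ?_
    fin_cases i
    exacts [hx, hy]
  refine DFunLike.coe_injective (hd.equalizer ρ.continuous_toFun ρ'.continuous_toFun ?_)
  funext g
  exact DFunLike.congr_fun h g

end SchurSigma

theorem mainTheorem2 (α : ℤ_[3]) (hα : α ^ 2 = -2) (hα₁ : (3 : ℤ_[3]) ∣ α - 1) :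
    ∃ ρ : SchurSigma.H →ₜ* Matrix.SpecialLinearGroup (Fin 2) ℤ_[3],
      (ρ SchurSigma.xH : Matrix (Fin 2) (Fin 2) ℤ_[3]) = !![0, -1; 1, -1] ∧
      (ρ SchurSigma.yH : Matrix (Fin 2) (Fin 2) ℤ_[3]) = α • !![0, SchurSigma.half; 1, -1] ∧
      (∀ ρ' : SchurSigma.H →ₜ* Matrix.SpecialLinearGroup (Fin 2) ℤ_[3],
        ρ' SchurSigma.xH = ρ SchurSigma.xH → ρ' SchurSigma.yH = ρ SchurSigma.yH → ρ' = ρ) ∧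
      ∃ P : Subgroup (Matrix.SpecialLinearGroup (Fin 2) ℤ_[3]),
        IsProPSylow 3 P ∧ ∃ e : SchurSigma.H ≃ₜ* P, ∀ h : SchurSigma.H,
          (e h : Matrix.SpecialLinearGroup (Fin 2) ℤ_[3]) = ρ h := by
  obtain ⟨ρF, hof, hker⟩ := SchurSigma.exists_rep_F hα hα₁
  let ρH : SchurSigma.H →* Matrix.SpecialLinearGroup (Fin 2) ℤ_[3] :=
    QuotientGroup.lift _ (ρF : SchurSigma.F →* Matrix.SpecialLinearGroup (Fin 2) ℤ_[3]) hker.ge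
  have hcont : Continuous ρH := ρF.continuous_toFun.quotient_lift _
  have hinj : Function.Injective ρH := by
    rw [injective_iff_map_eq_one]
    intro h hh
    obtain ⟨f, rfl⟩ := QuotientGroup.mk_surjective h
    exact (QuotientGroup.eq_one_iff f).2 (hker ▸ hh)
  refine ⟨⟨ρH, hcont⟩, congrArg Subtype.val ((hof _).trans (SchurSigma.freeRep_x hα)),
    congrArg Subtype.val ((hof _).trans (SchurSigma.freeRep_y hα)),
    fun ρ' hx hy => SchurSigma.hom_ext hx hy, ρH.range,
    SchurSigma.isProPSylow_range hα hα₁ hof fun g => ⟨?_, ?_⟩, ?_⟩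
  · rintro ⟨h, rfl⟩
    obtain ⟨f, rfl⟩ := QuotientGroup.mk_surjective h
    exact ⟨f, rfl⟩
  · rintro ⟨f, rfl⟩
    exact ⟨(f : SchurSigma.H), rfl⟩
  -- A continuous bijection from a compact space to a Hausdorff space has a continuous inverse.
  · let e := MonoidHom.ofInjective hinj
    have he : Continuous e := hcont.subtype_mk _
    exact ⟨⟨e, he, (he.homeoOfEquivCompactToT2 (f := e.toEquiv)).continuous_invFun⟩, fun h => rfl⟩
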